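/- Throughout, $q$ is a prime power, $q=p^k$ with $p$ prime; $\mathrm{tr}:\mathbb F_q\to\mathbb F_p$ is the field trace and $\omega=e^{2\pi i/p}$. A linear code $\mathcal D\subseteq\mathbb F_q^m$ ($m\ge 1$) is *$\eta$-biased* if $\left|\sum_{i=1}^m\omega^{\mathrm{tr}(a u_i)}\right|\le m\eta$ for every $u\in\mathcal D\setminus\{0\}$ and every $a\in\mathbb F_q\setminus\{0\}$. A *random $n$-puncturing* of $\mathcal D$ is the random code $\mathcal C=\{(x_{i_1},\dots,x_{i_n}) : x\in\mathcal D\}\subseteq\mathbb F_q^n$, where $i_1,\dots,i_n$ are independent and uniform in $\{1,\dots,m\}$; its *design rate* is $R=\frac{\log_q|\mathcal D|}{n}$. A code $\mathcal C\subseteq\mathbb F_q^n$ is *$(\rho,L)$-list-decodable* if there is no set of $L+1$ distinct codewords contained in a Hamming ball $\{u\in\mathbb F_q^n : |\{j: u_j\ne z_j\}|\le\rho n\}$, $z\in\mathbb F_q^n$. Finally, $h_q(\rho)=-\rho\log_q\rho-(1-\rho)\log_q(1-\rho)+\rho\log_q(q-1)$. **Statement.** There are constants $C_{\rho,q}$,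 depending only on $\rho$ and $q$, such that for every $\delta>0$ there is a constant $K=K(\delta)$ for which the following holds. Let $q$ be a prime power, $\rho\in(0,1-\frac1q)$, $L\ge 1$ an integer, $\varepsilon>0$, and let $n\ge 2$ satisfy $\frac{n}{\ln n}\ge K\,q^{2(L+1)}$. Let $\mathcal D\subseteq\mathbb F_q^m$ be a linear code that is $\left(\frac{\varepsilon(L+1)\ln q}{q^{L+1}}\right)$-biased, and let $\mathcal C$ be a random $n$-puncturing of $\mathcal D$, of design rate $R$. 1. If $R<1-h_q(\rho)-\frac{C_{\rho,q}}{L}-\varepsilon$, then $\mathcal C$ is $(\rho,L)$-list-decodable with probability at least $1-q^{-(\varepsilon-\delta)n}$. 2. If $q=2$, $L\ge 3$ and $R<1-h_2(\rho)\cdot\frac{L-1}{L-2}-\varepsilon$, then $\mathcal C$ is $(\rho,L)$-list-decodable with probability at least $1-2^{-(\varepsilon-\delta)n}$. In other words, when $n\to\infty$ with $\frac{n}{\log n}\ge\omega\!\left(q^{2(L+1)}\right)$ (in particular for fixed $q,\rho,L,\varepsilon$), these probabilities are at least $1-q^{-(\varepsilon-o(1))n}$, where the $o(1)$ term tends to $0$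 as $\frac{n}{q^{2(L+1)}\log n}\to\infty$. -/

import Mathlib

open MeasureTheory

namespace PuncturedCode

/-- The `q`-ary entropy function
`h_q(ρ) = -ρ log_q ρ - (1 - ρ) log_q (1 - ρ) + ρ log_q (q - 1)`
(Mathlib's `Real.qaryEntropy` is measured in nats). -/
noncomputable def entropy (q : ℕ) (ρ : ℝ) : ℝ :=
  Real.qaryEntropy q ρ / Real.log q

theorem entropy_eq (q : ℕ) (ρ : ℝ) :
    entropy q ρ = -ρ * Real.logb q ρ - (1 - ρ) * Real.logb q (1 - ρ)
      + ρ * Real.logb q ((q : ℝ) - 1) := by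
  unfold entropy
  simp only [Real.qaryEntropy, Real.binEntropy, Real.logb, Real.log_inv]
  push_cast
  ring

/-- The normalized Hamming weight of a vector of length `n`. -/
noncomputable def wt {F : Type*} [Field F] [DecidableEq F] {n : ℕ} (u : Fin n → F) : ℝ :=
  (hammingNorm u : ℝ) / n

/-- A set of vectors is `ρ`-clustered if it lies in a Hamming ball of normalized radius `ρ`. -/
def IsClustered {F : Type*} [Field F] [DecidableEq F] {n : ℕ} (ρ : ℝ)
    (W : Set (Fin n → F)) : Prop :=
  ∃ z : Fin n → F, ∀ u ∈ W, wt (u - z) ≤ ρ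

/-- A code is `(ρ, L)`-list-decodable if it contains no `ρ`-clustered set of `L + 1` codewords. -/
def IsListDecodable {F : Type*} [Field F] [DecidableEq F] {n : ℕ} (ρ : ℝ) (L : ℕ)
    (C : Set (Fin n → F)) : Prop :=
  ¬ ∃ W : Finset (Fin n → F), (W : Set (Fin n → F)) ⊆ C ∧ W.card = L + 1 ∧
    IsClustered ρ (W : Set (Fin n → F))

/-- The number `ω ^ tr(x)`, where `ω = exp (2 π i / p)` and `tr : F → 𝔽_p` is the field trace. -/
noncomputable def traceRoot (p : ℕ) {F : Type*} [Field F] [Algebra (ZMod p) F] (x : F) : ℂ :=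
  Complex.exp (2 * Real.pi * Complex.I / p) ^ (Algebra.trace (ZMod p) F x).val

/-- The vector `u` of length `m` is `η`-biased. -/
def IsBiasedVector (p : ℕ) {F : Type*} [Field F] [Algebra (ZMod p) F] {m : ℕ} (η : ℝ)
    (u : Fin m → F) : Prop :=
  ∀ a : F, a ≠ 0 → ‖∑ i, traceRoot p (a * u i)‖ ≤ m * η

/-- The linear code `D` is `η`-biased: every nonzero codeword is. -/
def IsBiased (p : ℕ) {F : Type*} [Field F] [Algebra (ZMod p) F] {m : ℕ} (η : ℝ)
    (D : Submodule F (Fin m → F)) : Prop :=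
  ∀ u ∈ D, u ≠ 0 → IsBiasedVector p η u

/-- The puncturing `{(x_{i_1}, …, x_{i_n}) | x ∈ D}` of the linear code `D`. -/
def puncture {F : Type*} [Field F] {m n : ℕ} (i : Fin n → Fin m)
    (D : Submodule F (Fin m → F)) : Submodule F (Fin n → F) :=
  D.map (LinearMap.funLeft F F i)

/-- The design rate `log_q |D| / n` of a length `n` puncturing of `D`, where `q = |F|`. -/
noncomputable def designRate {F : Type*} [Field F] [Fintype F] {m : ℕ} (n : ℕ)
    (D : Submodule F (Fin m → F)) : ℝ :=
  Real.logb (Fintype.card F) (Nat.card D) / n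

/-- The law of `n` independent uniform coordinates `i_1, …, i_n` from `[m]`. -/
noncomputable def coordLaw (m n : ℕ) [NeZero m] : Measure (Fin n → Fin m) :=
  Measure.pi fun _ => (PMF.uniformOfFintype (Fin m)).toMeasure

/-- The probability that a random `n`-puncturing of `D` is `(ρ, L)`-list-decodable. -/
noncomputable def probListDecodable {F : Type*} [Field F] [DecidableEq F] {m : ℕ} [NeZero m]
    (n : ℕ) (ρ : ℝ) (L : ℕ) (D : Submodule F (Fin m → F)) : ℝ :=
  (coordLaw m n).real
    {i | IsListDecodable ρ L (puncture i D : Set (Fin n → F))}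

end PuncturedCode

/-! Fix a failing puncturing. Translating the centre of a bad ball to the origin leaves a set `S` of
`L + 1` vectors of weight at most `ρ` whose differences lie in the punctured code. The plan is to
extract from `S` a subspace of the code, of dimension `k ≤ L`, that is too structured to appear by
chance: the joint law of its vectors at a uniform coordinate has entropy at most `k θ log q`, where
`θ` is slightly above `h_q(ρ)`.

Such subspaces are rare. By Fourier inversion, low bias makes the values of `k` independent
codewords at a random coordinate nearly uniform on `F^k` (`card_coord_eq_le`), so a given `n × k`
matrix arises with probability about `q^(-kn)`. Only about `q^(kθn)` matrices have small entropy, by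
the method of types (`card_ent_le`). With `q^(kRn)` tuples of codewords, the union bound in
`le_probListDecodable` gives the exponent `k (R + θ - 1)` plus a loss from the bias, at most `-ε`.

The extraction is deterministic. For `q = 2`, suppose every subspace `I` of differences has entropy
at least `θ dim I`. Cut `S` along a coordinate into two parallel slices and apply submodularity of
entropy to them and to the intersection of their direction spaces; induction bounds the entropy of
`S` so strongly that the space of all differences already violates the assumption
(`exists_submodule_of_not_isListDecodable_binary`).

For general `q`, take a basis of the span of `S` inside `S`. It has at most `k + 1` elements, each
of entropy at most that of `ρ`, so only one surplus vector has to be paid for. If the basis is large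
compared with `L`, the term `C / L` pays. Otherwise many combinations of the basis also have low
weight, and `exists_chain` finds boundedly many of them that behave almost independently; tilting
the reference law in Gibbs' inequality towards their zeros saves `log q` (`ent_rows_le_of_card_lt`).
-/

namespace PuncturedCode

/-! ### Entropy of functions on a finite uniform space, and counting by types. -/

section Entropy

open Classical in
/-- The size of the fibre of `g` through `i`. -/
noncomputable def fibreCard {ι α : Type*} [Fintype ι] (g : ι → α) (i : ι) : ℕ :=
  (Finset.univ.filter fun j => g j = g i).card

/-- The Shannon entropy (in nats) of `g i`, where `i` is uniform. -/
noncomputable def ent {ι α : Type*} [Fintype ι] (g : ι → α) : ℝ :=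
  (∑ i, (Real.log (Fintype.card ι) - Real.log (fibreCard g i))) / Fintype.card ι

variable {ι α β γ : Type*} [Fintype ι]

theorem fibreCard_pos (g : ι → α) (i : ι) : 0 < fibreCard g i := by
  classical
  exact Finset.card_pos.mpr ⟨i, by simp⟩

theorem fibreCard_congr {g : ι → α} {i j : ι} (h : g i = g j) :
    fibreCard g i = fibreCard g j := by
  unfold fibreCard
  rw [h]

theorem ent_mono {f : ι → α} {g : ι → β} (h : ∀ i j, g i = g j → f i = f j) :
    ent f ≤ ent g := by
  classical
  unfold ent
  gcongr with i _
  · exact_mod_cast fibreCard_pos g i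
  · refine Finset.card_le_card fun j hj => ?_
    simp only [Finset.mem_filter, Finset.mem_univ, true_and] at hj ⊢
    exact h _ _ hj

/-- Entropy depends only on the partition into fibres, which lets values be relabelled freely. -/
theorem ent_congr {f : ι → α} {g : ι → β} (h : ∀ i j, g i = g j ↔ f i = f j) :
    ent f = ent g :=
  le_antisymm (ent_mono fun i j => (h i j).1) (ent_mono fun i j => (h i j).2)

theorem sum_fibre_inv_le_one (g : ι → α) (x : α) [DecidableEq α] :
    ∑ i with g i = x, (1 : ℝ) / fibreCard g i ≤ 1 := by
  classical
  rcases (Finset.univ.filter fun i => g i = x).eq_empty_or_nonempty with h | ⟨i₀, h₀⟩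
  · rw [h]; simp
  · simp only [Finset.mem_filter, Finset.mem_univ, true_and] at h₀
    have : ∀ i ∈ Finset.univ.filter (fun i => g i = x),
        (1 : ℝ) / fibreCard g i = 1 / fibreCard g i₀ := by
      intro i hi
      simp only [Finset.mem_filter, Finset.mem_univ, true_and] at hi
      rw [fibreCard_congr (hi.trans h₀.symm)]
    rw [Finset.sum_congr rfl this, Finset.sum_const, nsmul_eq_mul]
    have h2 : (Finset.univ.filter fun i => g i = x).card = fibreCard g i₀ := by
      unfold fibreCard
      rw [h₀]
      congr
    rw [h2]
    have := fibreCard_pos g i₀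
    field_simp
    exact le_rfl

/-- Gibbs' inequality. -/
theorem ent_le_of_sum_le_one [Nonempty ι] [Fintype α] (g : ι → α) (ν : α → ℝ)
    (hν : ∀ x, 0 < ν x) (hsum : ∑ x, ν x ≤ 1) :
    ent g ≤ (∑ i, -Real.log (ν (g i))) / Fintype.card ι := by
  classical
  unfold ent
  have hn : (0 : ℝ) < Fintype.card ι := by exact_mod_cast Fintype.card_pos
  gcongr ?_ / _
  rw [← sub_nonpos, ← Finset.sum_sub_distrib]
  -- This is `log x ≤ x - 1` for the ratio of `ν` to the empirical law; the right side sums to at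
  -- most zero.
  have h1 : ∀ i, Real.log (Fintype.card ι) - Real.log (fibreCard g i) - -Real.log (ν (g i))
      ≤ Fintype.card ι * (ν (g i) * (1 / fibreCard g i)) - 1 := by
    intro i
    have hf : (0 : ℝ) < fibreCard g i := by exact_mod_cast fibreCard_pos g i
    have := Real.log_le_sub_one_of_pos
      (show 0 < Fintype.card ι * (ν (g i) * (1 / fibreCard g i)) by
        have := hν (g i); positivity)
    rw [Real.log_mul hn.ne' (by have := hν (g i); positivity),
      Real.log_mul (hν _).ne' (by positivity), one_div, Real.log_inv] at this
    rw [one_div]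
    linarith
  refine (Finset.sum_le_sum fun i _ => h1 i).trans ?_
  rw [Finset.sum_sub_distrib, ← Finset.mul_sum]
  simp only [Finset.sum_const, Finset.card_univ, nsmul_eq_mul, mul_one]
  have h2 : ∑ i, ν (g i) * (1 / fibreCard g i : ℝ) ≤ 1 := by
    rw [← Finset.sum_fiberwise (s := Finset.univ) (g := g)]
    refine le_trans (Finset.sum_le_sum fun x _ => ?_) hsum
    calc ∑ i with g i = x, ν (g i) * (1 / fibreCard g i : ℝ)
        = ν x * ∑ i with g i = x, (1 / fibreCard g i : ℝ) := by
          rw [Finset.mul_sum]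
          refine Finset.sum_congr rfl fun i hi => ?_
          rw [(Finset.mem_filter.mp hi).2]
      _ ≤ ν x * 1 := mul_le_mul_of_nonneg_left (sum_fibre_inv_le_one g x) (hν x).le
      _ = ν x := mul_one _
  nlinarith

/-- Submodularity of entropy. -/
theorem ent_pair_add_le (X : ι → α) (Y : ι → β) (W : ι → γ)
    (hX : ∀ i j, X i = X j → W i = W j) (hY : ∀ i j, Y i = Y j → W i = W j) :
    ent (fun i => (X i, Y i)) + ent W ≤ ent X + ent Y := by
  classical
  set P := fun i => (X i, Y i) with hP
  have hpP : ∀ i, (0 : ℝ) < fibreCard P i := fun i => by exact_mod_cast fibreCard_pos P i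
  have hpX : ∀ i, (0 : ℝ) < fibreCard X i := fun i => by exact_mod_cast fibreCard_pos X i
  have hpY : ∀ i, (0 : ℝ) < fibreCard Y i := fun i => by exact_mod_cast fibreCard_pos Y i
  have hpW : ∀ i, (0 : ℝ) < fibreCard W i := fun i => by exact_mod_cast fibreCard_pos W i
  unfold ent
  rw [← add_div, ← add_div, ← Finset.sum_add_distrib, ← Finset.sum_add_distrib]
  gcongr ?_ / _
  rw [← sub_nonpos, ← Finset.sum_sub_distrib]
  have h1 : ∀ i, (Real.log (Fintype.card ι) - Real.log (fibreCard P i)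
        + (Real.log (Fintype.card ι) - Real.log (fibreCard W i)))
      - (Real.log (Fintype.card ι) - Real.log (fibreCard X i)
        + (Real.log (Fintype.card ι) - Real.log (fibreCard Y i)))
      ≤ (fibreCard X i * fibreCard Y i : ℝ) * (1 / fibreCard P i * (1 / fibreCard W i)) - 1 := by
    intro i
    have h := Real.log_le_sub_one_of_pos
      (show 0 < (fibreCard X i * fibreCard Y i : ℝ) * (1 / fibreCard P i * (1 / fibreCard W i)) by
        have := hpP i; have := hpX i; have := hpY i; have := hpW i; positivity)
    rw [Real.log_mul (mul_pos (hpX i) (hpY i)).ne'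
      (mul_pos (one_div_pos.2 (hpP i)) (one_div_pos.2 (hpW i))).ne',
      Real.log_mul (hpX i).ne' (hpY i).ne', Real.log_mul (one_div_pos.2 (hpP i)).ne'
      (one_div_pos.2 (hpW i)).ne', Real.log_div one_ne_zero (hpP i).ne',
      Real.log_div one_ne_zero (hpW i).ne', Real.log_one] at h
    linarith
  refine (Finset.sum_le_sum fun i _ => h1 i).trans ?_
  rw [Finset.sum_sub_distrib, sub_nonpos]
  -- The product of fibre sizes counts pairs `(j, l)`. After exchanging sums, a fixed pair leaves
  -- the `i` in one fibre of `P`, on which the inverse sizes sum to at most one; that fibre is empty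
  -- unless `W l = W j`.
  have h2 : ∀ i, (fibreCard X i * fibreCard Y i : ℝ) * (1 / fibreCard P i * (1 / fibreCard W i))
      = ∑ j, ∑ l, if X j = X i ∧ Y l = Y i then
          (1 / fibreCard P i * (1 / fibreCard W i) : ℝ) else 0 := by
    intro i
    rw [← Finset.sum_product', ← Finset.sum_filter, Finset.sum_const, nsmul_eq_mul]
    congr 1
    have : (Finset.univ ×ˢ Finset.univ).filter (fun x : ι × ι => X x.1 = X i ∧ Y x.2 = Y i)
        = (Finset.univ.filter fun j => X j = X i) ×ˢ (Finset.univ.filter fun j => Y j = Y i) := by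
      ext x; simp
    rw [this, Finset.card_product]
    push_cast
    congr! 1
  rw [Finset.sum_congr rfl fun i _ => h2 i, Finset.sum_comm]
  refine Finset.sum_le_sum fun j _ => ?_
  rw [Finset.sum_comm]
  have h3 : ∀ l, (∑ i, if X j = X i ∧ Y l = Y i then
          (1 / fibreCard P i * (1 / fibreCard W i) : ℝ) else 0)
      ≤ if W l = W j then (1 / fibreCard W j : ℝ) else 0 := by
    intro l
    by_cases hw : W l = W j
    · rw [if_pos hw, ← Finset.sum_filter]
      calc ∑ i with X j = X i ∧ Y l = Y i, (1 / fibreCard P i * (1 / fibreCard W i) : ℝ)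
          = (∑ i with P i = (X j, Y l), (1 / fibreCard P i : ℝ)) * (1 / fibreCard W j) := by
            rw [Finset.sum_mul]
            refine Finset.sum_congr ?_ ?_
            · ext i; simp [hP, eq_comm]
            · intro i hi
              simp only [Finset.mem_filter, Finset.mem_univ, true_and, hP, Prod.mk.injEq] at hi
              rw [fibreCard_congr (hX i j hi.1)]
        _ ≤ 1 * (1 / fibreCard W j) :=
            mul_le_mul_of_nonneg_right (sum_fibre_inv_le_one P _) (one_div_pos.2 (hpW j)).le
        _ = _ := one_mul _
    · rw [if_neg hw]
      refine (Finset.sum_eq_zero fun i _ => if_neg ?_).le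
      rintro ⟨h, h'⟩
      exact hw ((hY _ _ h').trans (hX _ _ h).symm)
  refine (Finset.sum_le_sum fun l _ => h3 l).trans ?_
  rw [← Finset.sum_filter, Finset.sum_const, nsmul_eq_mul]
  have : ((Finset.univ.filter fun l => W l = W j).card : ℝ) = fibreCard W j := by
    unfold fibreCard; congr!
  rw [this]
  have := hpW j
  field_simp
  exact le_rfl

/-- Under the product law with marginal `t / n`, each sequence of type `t` has mass exactly `exp (-n
· ent g)`, hence at least `exp (-n c)` here, while the total mass is one. -/
theorem card_fibres_le [Fintype α] [DecidableEq α] [DecidableEq ι] [Nonempty ι] (c : ℝ)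
    (t : α → ℕ) :
    ((Finset.univ.filter fun g : ι → α => ent g ≤ c ∧
      ∀ x, (Finset.univ.filter fun i => g i = x).card = t x).card : ℝ)
      ≤ Real.exp (Fintype.card ι * c) := by
  classical
  set n : ℝ := (Fintype.card ι : ℝ) with hn
  have hn0 : 0 < n := by rw [hn]; exact_mod_cast Fintype.card_pos
  set T := Finset.univ.filter fun g : ι → α => ent g ≤ c ∧
      ∀ x, (Finset.univ.filter fun i => g i = x).card = t x with hT
  rcases T.eq_empty_or_nonempty with h | ⟨g₀, h₀⟩
  · rw [h]; simp [Real.exp_nonneg]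
  have hsum : ∑ x, (t x : ℝ) / n = 1 := by
    rw [← Finset.sum_div, div_eq_one_iff_eq hn0.ne']
    simp only [hT, Finset.mem_filter, Finset.mem_univ, true_and] at h₀
    simp only [← h₀.2]
    rw [hn, ← Finset.card_univ, Finset.card_eq_sum_card_fiberwise
      (f := g₀) (t := Finset.univ) (by simp)]
    push_cast
    rfl
  have hprod : ∀ g ∈ T, Real.exp (-(n * c)) ≤ ∏ i, (t (g i) : ℝ) / n := by
    intro g hg
    simp only [hT, Finset.mem_filter, Finset.mem_univ, true_and] at hg
    have e1 : ∀ i, (t (g i) : ℝ) / n = Real.exp (-(Real.log n - Real.log (fibreCard g i))) := by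
      intro i
      have hf : (0 : ℝ) < fibreCard g i := by exact_mod_cast fibreCard_pos g i
      rw [neg_sub, Real.exp_sub, Real.exp_log hf, Real.exp_log hn0, ← hg.2]
      unfold fibreCard
      congr!
    rw [Finset.prod_congr rfl fun i _ => e1 i, ← Real.exp_sum, Real.exp_le_exp,
      Finset.sum_neg_distrib, neg_le_neg_iff]
    have := hg.1
    unfold ent at this
    rw [div_le_iff₀ (by simpa [hn] using hn0)] at this
    rw [mul_comm]
    exact this
  have htot : ∑ g : ι → α, ∏ i, (t (g i) : ℝ) / n = 1 := by
    have := Fintype.prod_sum fun (_ : ι) (x : α) => (t x : ℝ) / n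
    rw [← this]
    simp [hsum]
  have h1 : (T.card : ℝ) * Real.exp (-(n * c)) ≤ 1 := by
    rw [← nsmul_eq_mul, ← Finset.sum_const]
    refine (Finset.sum_le_sum hprod).trans ?_
    rw [← htot]
    exact Finset.sum_le_sum_of_subset_of_nonneg (Finset.subset_univ _)
      fun g _ _ => Finset.prod_nonneg fun i _ => by positivity
  rw [Real.exp_neg, ← div_eq_mul_inv, div_le_one (Real.exp_pos _)] at h1
  exact h1

/-- There are few sequences of small entropy. -/
theorem card_ent_le [Fintype α] [DecidableEq ι] [Nonempty ι] (c : ℝ) :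
    ((Finset.univ.filter fun g : ι → α => ent g ≤ c).card : ℝ)
      ≤ ((Fintype.card ι : ℝ) + 1) ^ Fintype.card α * Real.exp (Fintype.card ι * c) := by
  classical
  let τ : (ι → α) → (α → Fin (Fintype.card ι + 1)) := fun g x =>
    ⟨(Finset.univ.filter fun i => g i = x).card, Nat.lt_succ_of_le (Finset.card_le_univ _)⟩
  rw [Finset.card_eq_sum_card_fiberwise (f := τ) (t := Finset.univ) (by simp)]
  push_cast
  calc _ ≤ ∑ _t : α → Fin (Fintype.card ι + 1), Real.exp (Fintype.card ι * c) := by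
        refine Finset.sum_le_sum fun t _ => ?_
        refine le_trans ?_ (card_fibres_le (ι := ι) c fun x => (t x : ℕ))
        rw [Finset.filter_filter]
        norm_cast
        refine Finset.card_le_card fun g hg => ?_
        simp only [Finset.mem_filter, Finset.mem_univ, true_and] at hg ⊢
        refine ⟨hg.1, fun x => ?_⟩
        rw [← hg.2]
    _ = _ := by
        simp

end Entropy

/-! ### Low bias, the union bound over small-entropy matrices, and the failure probability. -/

section Probability

variable (p : ℕ) [Fact p.Prime] {F : Type*} [Field F] [Algebra (ZMod p) F]

/-- The additive character `x ↦ ω ^ tr(x)`. -/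
noncomputable def traceChar : AddChar F ℂ :=
  (ZMod.stdAddChar (N := p)).compAddMonoidHom (Algebra.trace (ZMod p) F).toAddMonoidHom

theorem traceRoot_eq (x : F) : traceRoot p x = traceChar p x := by
  have h : traceChar p x = ZMod.stdAddChar (N := p) (Algebra.trace (ZMod p) F x) := rfl
  rw [h, traceRoot, ← Complex.exp_nat_mul]
  have h2 := ZMod.stdAddChar_coe (N := p) (((Algebra.trace (ZMod p) F x).val : ℕ) : ℤ)
  rw [Int.cast_natCast, ZMod.natCast_zmod_val] at h2
  rw [h2]
  congr 1
  push_cast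
  ring

variable [Fintype F]

theorem traceChar_isPrimitive : (traceChar p : AddChar F ℂ).IsPrimitive := by
  refine AddChar.IsPrimitive.of_ne_one fun h => ?_
  obtain ⟨x, hx⟩ := Algebra.trace_surjective (ZMod p) F 1
  have h1 : ZMod.stdAddChar (N := p) (Algebra.trace (ZMod p) F x) = 1 :=
    DFunLike.congr_fun h x
  rw [hx, ← AddChar.map_zero_eq_one (ZMod.stdAddChar (N := p))] at h1
  exact one_ne_zero (ZMod.injective_stdAddChar h1)

theorem sum_traceChar_dot [DecidableEq F] {k : ℕ} (y : Fin k → F) :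
    ∑ a : Fin k → F, traceChar p (∑ j, a j * y j)
      = if y = 0 then (Fintype.card F : ℂ) ^ k else 0 := by
  have h : ∀ a : Fin k → F, traceChar p (∑ j, a j * y j) = ∏ j, traceChar p (a j * y j) :=
    fun a => by
      suffices ∀ s : Finset (Fin k),
          traceChar p (∑ j ∈ s, a j * y j) = ∏ j ∈ s, traceChar p (a j * y j) from this _
      intro s
      induction s using Finset.induction_on with
      | empty => simp
      | insert j s hj ih =>
        rw [Finset.sum_insert hj, Finset.prod_insert hj, AddChar.map_add_eq_mul, ih]
  rw [Finset.sum_congr rfl fun a _ => h a]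
  have := Fintype.prod_sum fun (j : Fin k) (x : F) => (traceChar p (x * y j) : ℂ)
  rw [← this]
  simp only [AddChar.sum_mulShift _ (traceChar_isPrimitive p)]
  split_ifs with hy
  · simp [hy]
  · obtain ⟨j, hj⟩ := Function.ne_iff.mp hy
    exact Finset.prod_eq_zero (Finset.mem_univ j) (by simpa using hj)

/-- Coordinates of linearly independent codewords of a low-bias code are nearly uniform. -/
theorem card_coord_eq_le [DecidableEq F] {m k : ℕ} {η : ℝ} (hη : 0 ≤ η) (u : Fin k → Fin m → F)
    (hu : ∀ a : Fin k → F, a ≠ 0 → ‖∑ i, traceRoot p (∑ j, a j * u j i)‖ ≤ m * η)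
    (x : Fin k → F) :
    ((Finset.univ.filter fun t => (fun j => u j t) = x).card : ℝ) * (Fintype.card F : ℝ) ^ k
      ≤ m * (1 + (Fintype.card F : ℝ) ^ k * η) := by
  classical
  -- Fourier inversion on `F^k`. The trivial character contributes at most `m`, each other one at
  -- most `m η`.
  have h1 : ((Finset.univ.filter fun t => (fun j => u j t) = x).card : ℂ)
      * (Fintype.card F : ℂ) ^ k
      = ∑ a : Fin k → F, traceChar p (- ∑ j, a j * x j)
          * ∑ t, traceRoot p (∑ j, a j * u j t) := by
    calc _ = ∑ t, if (fun j => u j t - x j) = 0 then (Fintype.card F : ℂ) ^ k else 0 := by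
          rw [← Finset.sum_filter, Finset.sum_const, nsmul_eq_mul]
          congr 4
          ext t
          simp [funext_iff, sub_eq_zero]
      _ = ∑ t, ∑ a : Fin k → F, traceChar p (∑ j, a j * (u j t - x j)) :=
          Finset.sum_congr rfl fun t _ => (sum_traceChar_dot p _).symm
      _ = _ := by
          rw [Finset.sum_comm]
          refine Finset.sum_congr rfl fun a _ => ?_
          rw [Finset.mul_sum]
          refine Finset.sum_congr rfl fun t _ => ?_
          rw [traceRoot_eq, ← AddChar.map_add_eq_mul]
          congr 1
          simp only [mul_sub, Finset.sum_sub_distrib]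
          ring
  have hnorm : ∀ y : F, ‖(traceChar p y : ℂ)‖ = 1 := fun y => AddChar.norm_apply _ _
  have h2 := congrArg norm h1
  rw [norm_mul, norm_pow, Complex.norm_natCast, Complex.norm_natCast] at h2
  rw [h2]
  refine (norm_sum_le _ _).trans ?_
  simp only [norm_mul, hnorm, one_mul]
  rw [← Finset.add_sum_erase _ _ (Finset.mem_univ (0 : Fin k → F))]
  have h3 : ‖∑ t : Fin m, traceRoot p (∑ j, (0 : Fin k → F) j * u j t)‖ ≤ m := by
    refine (norm_sum_le _ _).trans ?_
    simp [traceRoot_eq]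
  have h4 : ∑ a ∈ Finset.univ.erase (0 : Fin k → F),
      ‖∑ t : Fin m, traceRoot p (∑ j, a j * u j t)‖ ≤ (Fintype.card F : ℝ) ^ k * (m * η) := by
    refine (Finset.sum_le_sum fun a ha => hu a (Finset.ne_of_mem_erase ha)).trans ?_
    rw [Finset.sum_const, nsmul_eq_mul]
    refine mul_le_mul_of_nonneg_right ?_ (by positivity)
    have := Finset.card_le_univ (Finset.univ.erase (0 : Fin k → F))
    rw [Fintype.card_fun, Fintype.card_fin] at this
    exact_mod_cast this
  linarith

theorem coordLaw_pi {m n : ℕ} [NeZero m] (A : Fin n → Finset (Fin m)) :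
    (coordLaw m n).real {i | ∀ t, i t ∈ A t} = ∏ t, ((A t).card : ℝ) / m := by
  have h : {i : Fin n → Fin m | ∀ t, i t ∈ A t} = Set.pi Set.univ fun t => (A t : Set (Fin m)) := by
    ext i; simp
  rw [h, Measure.real, coordLaw, Measure.pi_pi, ENNReal.toReal_prod]
  refine Finset.prod_congr rfl fun t _ => ?_
  rw [PMF.toMeasure_uniformOfFintype_apply _ (Set.toFinite _).measurableSet]
  simp

instance {m n : ℕ} [NeZero m] : IsProbabilityMeasure (coordLaw m n) := by
  unfold coordLaw; infer_instance

theorem prob_rows_eq_le [DecidableEq F] {m n k : ℕ} [NeZero m] {η : ℝ} (hη : 0 ≤ η)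
    {D : Submodule F (Fin m → F)} (hD : IsBiased p η D) (u : Fin k → D)
    (hu : LinearIndependent F u) (M : Fin n → Fin k → F) :
    (coordLaw m n).real {i | (fun t j => (u j : Fin m → F) (i t)) = M}
      ≤ ((1 + (Fintype.card F : ℝ) ^ k * η) / (Fintype.card F : ℝ) ^ k) ^ n := by
  have hset : {i : Fin n → Fin m | (fun t j => (u j : Fin m → F) (i t)) = M}
      = {i | ∀ t, i t ∈ Finset.univ.filter fun s => (fun j => (u j : Fin m → F) s) = M t} := by
    ext i; simp [funext_iff]
  have hm : (0 : ℝ) < m := by exact_mod_cast Nat.pos_of_ne_zero (NeZero.ne m)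
  have hq : (0 : ℝ) < (Fintype.card F : ℝ) ^ k :=
    pow_pos (by exact_mod_cast Fintype.card_pos) _
  rw [hset, coordLaw_pi]
  refine (Finset.prod_le_prod (fun t _ => by positivity) fun t _ => ?_).trans
    (by rw [Finset.prod_const, Finset.card_univ, Fintype.card_fin])
  rw [div_le_div_iff₀ hm hq, mul_comm _ (m : ℝ)]
  refine card_coord_eq_le p hη (fun j => (u j : Fin m → F)) (fun a ha => ?_) (M t)
  -- Linear independence turns every nonzero character into a nonzero codeword of `D`, to which the
  -- bias bound applies.
  have hne : (∑ j, a j • u j) ≠ 0 := by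
    intro h0
    exact ha (funext (Fintype.linearIndependent_iff.mp hu a h0))
  have := hD (∑ j, a j • u j : D) (Submodule.coe_mem _)
    (by rwa [Ne, ZeroMemClass.coe_eq_zero]) 1 one_ne_zero
  simpa using this

/-- The expected number of tuples of codewords whose empirical law has small entropy. -/
theorem prob_exists_ent_le [DecidableEq F] {m n k : ℕ} [NeZero m] [NeZero n] {η : ℝ}
    (hη : 0 ≤ η) {D : Submodule F (Fin m → F)} (hD : IsBiased p η D) (c : ℝ) :
    (coordLaw m n).real {i | ∃ u : Fin k → D, LinearIndependent F u ∧
        ent (fun (t : Fin n) (j : Fin k) => (u j : Fin m → F) (i t)) ≤ c}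
      ≤ (Nat.card D : ℝ) ^ k * (((n : ℝ) + 1) ^ (Fintype.card F ^ k) * Real.exp (n * c))
        * ((1 + (Fintype.card F : ℝ) ^ k * η) / (Fintype.card F : ℝ) ^ k) ^ n := by
  classical
  have hfin : Fintype D := Fintype.ofFinite _
  set A := Finset.univ.filter fun u : Fin k → D => LinearIndependent F u with hA
  set B := Finset.univ.filter fun M : Fin n → Fin k → F => ent M ≤ c with hB
  have hsub : {i : Fin n → Fin m | ∃ u : Fin k → D, LinearIndependent F u ∧
        ent (fun (t : Fin n) (j : Fin k) => (u j : Fin m → F) (i t)) ≤ c}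
      ⊆ ⋃ x ∈ A ×ˢ B, {i | (fun t j => (x.1 j : Fin m → F) (i t)) = x.2} := by
    rintro i ⟨u, hu, he⟩
    simp only [Set.mem_iUnion]
    exact ⟨(u, fun t j => (u j : Fin m → F) (i t)), by simp [hA, hB, hu, he], rfl⟩
  refine (measureReal_mono hsub (measure_ne_top _ _)).trans ((measureReal_biUnion_finset_le _ _).trans ?_)
  refine (Finset.sum_le_sum (g := fun _ => ((1 + (Fintype.card F : ℝ) ^ k * η) /
    (Fintype.card F : ℝ) ^ k) ^ n) fun x hx => ?_).trans ?_
  · have := (Finset.mem_product.mp hx).1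
    exact prob_rows_eq_le p hη hD x.1 (by simpa [hA] using this) x.2
  · rw [Finset.sum_const, nsmul_eq_mul, Finset.card_product]
    push_cast
    have hA' : (A.card : ℝ) ≤ (Nat.card D : ℝ) ^ k := by
      have := Finset.card_le_univ A
      rw [Fintype.card_fun, Fintype.card_fin, ← Nat.card_eq_fintype_card] at this
      exact_mod_cast this
    have hB' := card_ent_le (ι := Fin n) (α := Fin k → F) c
    rw [Fintype.card_fun, Fintype.card_fin, Fintype.card_fin] at hB'
    gcongr

theorem nat_card_eq_rpow_designRate {m n : ℕ} [NeZero n] (D : Submodule F (Fin m → F)) :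
    (Nat.card D : ℝ) = (Fintype.card F : ℝ) ^ (designRate n D * n) := by
  have hq : (1 : ℝ) < Fintype.card F := by exact_mod_cast Fintype.one_lt_card
  have hn : (n : ℝ) ≠ 0 := by exact_mod_cast NeZero.ne n
  rw [designRate, div_mul_cancel₀ _ hn, Real.rpow_logb (by linarith) hq.ne']
  exact_mod_cast Nat.card_pos

theorem designRate_nonneg {m n : ℕ} (D : Submodule F (Fin m → F)) : 0 ≤ designRate n D := by
  have hq : (1 : ℝ) < Fintype.card F := by exact_mod_cast Fintype.one_lt_card
  refine div_nonneg (Real.logb_nonneg hq ?_) (Nat.cast_nonneg _)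
  exact_mod_cast Nat.card_pos

/-- The 3 is a budget in units of `Q log n`, with `Q = q^(L+1)`: one unit bounds the number `L` of
dimensions, two bound `(n + 1)^Q ≤ n^(2Q)`. -/
theorem poly_factor_le {δ : ℝ} (hδ : 0 < δ) {q L n : ℕ} (hq : 2 ≤ q) (hn : 2 ≤ n)
    (hK : 3 / (δ * Real.log 2) * (q : ℝ) ^ (2 * (L + 1)) ≤ (n : ℝ) / Real.log n) :
    (L : ℝ) * ((n : ℝ) + 1) ^ (q ^ (L + 1)) ≤ (q : ℝ) ^ (δ * n) := by
  have hn' : (2 : ℝ) ≤ n := by exact_mod_cast hn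
  have hq' : (2 : ℝ) ≤ q := by exact_mod_cast hq
  have hl2 : 0 < Real.log 2 := Real.log_pos (by norm_num)
  have hln : Real.log 2 ≤ Real.log n := Real.log_le_log (by norm_num) hn'
  have hlq : Real.log 2 ≤ Real.log q := Real.log_le_log (by norm_num) hq'
  set Q : ℝ := (q : ℝ) ^ (L + 1) with hQ
  have hQ1 : 1 ≤ Q := one_le_pow₀ (by linarith)
  have hQL : (L : ℝ) + 1 ≤ Q := by
    have h1 : L + 1 < 2 ^ (L + 1) := Nat.lt_two_pow_self
    have h2 : ((L + 1 : ℕ) : ℝ) ≤ (2 : ℝ) ^ (L + 1) := by exact_mod_cast h1.le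
    push_cast at h2
    exact h2.trans (pow_le_pow_left₀ (by norm_num) hq' _)
  have hQ2 : (q : ℝ) ^ (2 * (L + 1)) = Q ^ 2 := by rw [hQ, ← pow_mul, mul_comm]
  rw [hQ2, le_div_iff₀ (by linarith)] at hK
  have h3 : 3 * Q * Real.log n ≤ δ * n * Real.log q := by
    have : 3 * Q ^ 2 * Real.log n ≤ δ * Real.log 2 * n := by
      calc 3 * Q ^ 2 * Real.log n
          = δ * Real.log 2 * (3 / (δ * Real.log 2) * Q ^ 2 * Real.log n) := by field_simp
        _ ≤ _ := by gcongr
    calc 3 * Q * Real.log n ≤ 3 * Q ^ 2 * Real.log n := by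
          have : Q ≤ Q ^ 2 := by nlinarith
          have : 0 ≤ Real.log n := by linarith
          gcongr
      _ ≤ δ * Real.log 2 * n := this
      _ ≤ _ := by
          have : 0 ≤ δ * n := by positivity
          nlinarith
  have hexp : (n : ℝ) + 1 ≤ Real.exp (2 * Real.log n) := by
    rw [mul_comm, Real.exp_mul, Real.exp_log (by linarith)]
    norm_num
    nlinarith
  have hL : (L : ℝ) ≤ Real.exp (Q * Real.log n) := by
    have h1 : (L : ℝ) < 2 ^ L := by exact_mod_cast Nat.lt_two_pow_self
    have h2 : (2 : ℝ) ^ L = Real.exp (L * Real.log 2) := by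
      rw [mul_comm, Real.exp_mul, Real.exp_log (by norm_num), Real.rpow_natCast]
    rw [h2] at h1
    refine h1.le.trans (Real.exp_le_exp.2 ?_)
    gcongr
    linarith
  have hcast : ((q ^ (L + 1) : ℕ) : ℝ) = Q := by push_cast; rfl
  calc (L : ℝ) * ((n : ℝ) + 1) ^ (q ^ (L + 1))
      ≤ Real.exp (Q * Real.log n) * Real.exp (2 * Real.log n) ^ (q ^ (L + 1)) := by gcongr
    _ = Real.exp (3 * Q * Real.log n) := by
        rw [← Real.exp_nat_mul, ← Real.exp_add, hcast]
        congr 1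
        ring
    _ ≤ Real.exp (δ * n * Real.log q) := Real.exp_le_exp.2 h3
    _ = _ := by rw [mul_comm, Real.exp_mul, Real.exp_log (by linarith)]

/-- If every failure of list decodability produces, for some `k`, a `k`-dimensional family of
codewords of small entropy, then list decoding fails with exponentially small probability. -/
theorem le_probListDecodable [DecidableEq F] {δ ε ρ θ : ℝ} (hδ : 0 < δ) (hε : 0 < ε) {k₀ L : ℕ}
    {m n : ℕ} [NeZero m] (hn : 2 ≤ n) (hk₀ : 1 ≤ k₀)
    (hK : 3 / (δ * Real.log 2) * (Fintype.card F : ℝ) ^ (2 * (L + 1)) ≤ (n : ℝ) / Real.log n)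
    {D : Submodule F (Fin m → F)}
    (hD : IsBiased p (ε * ((L : ℝ) + 1) * Real.log (Fintype.card F)
      / (Fintype.card F : ℝ) ^ (L + 1)) D)
    (hnum : ∀ k ∈ Finset.Icc k₀ L, (k : ℝ) * (designRate n D + θ - 1)
      + ε * ((L : ℝ) + 1) * ((Fintype.card F : ℝ) ^ k / (Fintype.card F : ℝ) ^ (L + 1)) ≤ -ε)
    (hdet : ∀ i : Fin n → Fin m, ¬ IsListDecodable ρ L (puncture i D : Set (Fin n → F)) →
      ∃ k ∈ Finset.Icc k₀ L, ∃ u : Fin k → D, LinearIndependent F u ∧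
        ent (fun (t : Fin n) (j : Fin k) => (u j : Fin m → F) (i t))
          ≤ k * (θ * Real.log (Fintype.card F))) :
    1 - (Fintype.card F : ℝ) ^ (-(ε - δ) * (n : ℝ)) ≤ probListDecodable n ρ L D := by
  classical
  have : NeZero n := ⟨by omega⟩
  set q := Fintype.card F with hq
  have hq2 : 2 ≤ q := Fintype.one_lt_card
  have hq' : (2 : ℝ) ≤ q := by exact_mod_cast hq2
  have hlq : 0 < Real.log q := Real.log_pos (by linarith)
  set R := designRate n D with hR
  set η := ε * ((L : ℝ) + 1) * Real.log q / (q : ℝ) ^ (L + 1) with hηdef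
  have hη : 0 ≤ η := by positivity
  set G := {i : Fin n → Fin m | IsListDecodable ρ L (puncture i D : Set (Fin n → F))} with hG
  let E : ℕ → Set (Fin n → Fin m) := fun k => {i | ∃ u : Fin k → D, LinearIndependent F u ∧
        ent (fun (t : Fin n) (j : Fin k) => (u j : Fin m → F) (i t)) ≤ k * (θ * Real.log q)}
  have hcompl : Gᶜ ⊆ ⋃ k ∈ Finset.Icc k₀ L, E k := by
    intro i hi
    obtain ⟨k, hk, u, hu⟩ := hdet i hi
    simp only [Set.mem_iUnion]
    exact ⟨k, hk, u, hu⟩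
  have hE : ∀ k ∈ Finset.Icc k₀ L, (coordLaw m n).real (E k)
      ≤ ((n : ℝ) + 1) ^ (q ^ (L + 1)) * Real.exp (-(n * ε * Real.log q)) := by
    intro k hk
    have hkL := (Finset.mem_Icc.mp hk).2
    refine (prob_exists_ent_le p hη hD _).trans ?_
    have hqk : (0 : ℝ) < (q : ℝ) ^ k := by positivity
    have e1 : (Nat.card D : ℝ) ^ k = Real.exp (n * (k * R * Real.log q)) := by
      rw [nat_card_eq_rpow_designRate (n := n) D, ← hq, ← hR, ← Real.rpow_natCast,
        ← Real.rpow_mul (by positivity), Real.rpow_def_of_pos (by positivity)]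
      congr 1
      ring
    -- By `1 + x ≤ exp x`, the bias costs `q^k η` nats per coordinate, which is `ε (L + 1)
    -- q^(k-L-1)` in units of `log q`: the second term of `hnum`.
    have e2 : ((1 + (q : ℝ) ^ k * η) / (q : ℝ) ^ k) ^ n
        ≤ Real.exp (n * ((q : ℝ) ^ k * η - k * Real.log q)) := by
      have hk : Real.exp (k * Real.log q) = (q : ℝ) ^ k := by
        rw [Real.exp_nat_mul, Real.exp_log (by linarith)]
      rw [Real.exp_nat_mul, Real.exp_sub, hk]
      have := Real.add_one_le_exp ((q : ℝ) ^ k * η)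
      gcongr
      linarith
    have e3 : ((n : ℝ) + 1) ^ (q ^ k) ≤ ((n : ℝ) + 1) ^ (q ^ (L + 1)) := by
      gcongr
      · linarith [Nat.cast_nonneg (α := ℝ) n]
      · omega
      · omega
    calc _ ≤ Real.exp (n * (k * R * Real.log q)) * (((n : ℝ) + 1) ^ (q ^ (L + 1))
          * Real.exp (n * (k * (θ * Real.log q))))
          * Real.exp (n * ((q : ℝ) ^ k * η - k * Real.log q)) := by
          rw [e1]
          gcongr
      _ = ((n : ℝ) + 1) ^ (q ^ (L + 1)) * Real.exp (n * Real.log q * (k * (R + θ - 1)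
            + ε * (L + 1) * ((q : ℝ) ^ k / (q : ℝ) ^ (L + 1)))) := by
          have : Real.exp (n * Real.log q * (k * (R + θ - 1)
              + ε * (L + 1) * ((q : ℝ) ^ k / (q : ℝ) ^ (L + 1))))
              = Real.exp (n * (k * R * Real.log q)) * Real.exp (n * (k * (θ * Real.log q)))
                * Real.exp (n * ((q : ℝ) ^ k * η - k * Real.log q)) := by
            rw [← Real.exp_add, ← Real.exp_add, hηdef]
            congr 1
            ring
          rw [this]
          ring
      _ ≤ _ := by
          refine mul_le_mul_of_nonneg_left (Real.exp_le_exp.2 ?_) (by positivity)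
          have := mul_le_mul_of_nonneg_left (hnum k hk)
            (show 0 ≤ n * Real.log q by positivity)
          linarith
  have hbad : (coordLaw m n).real Gᶜ ≤ (q : ℝ) ^ (-(ε - δ) * (n : ℝ)) := by
    refine (measureReal_mono hcompl (measure_ne_top _ _)).trans ((measureReal_biUnion_finset_le _ _).trans
      ((Finset.sum_le_sum hE).trans ?_))
    rw [Finset.sum_const, nsmul_eq_mul, Nat.card_Icc]
    have hc : ((L + 1 - k₀ : ℕ) : ℝ) ≤ L := by
      exact_mod_cast (show L + 1 - k₀ ≤ L by omega)
    calc _ ≤ (L : ℝ) * (((n : ℝ) + 1) ^ (q ^ (L + 1)) * Real.exp (-(n * ε * Real.log q))) := by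
          gcongr
      _ = (L : ℝ) * ((n : ℝ) + 1) ^ (q ^ (L + 1)) * Real.exp (-(n * ε * Real.log q)) := by ring
      _ ≤ (q : ℝ) ^ (δ * n) * Real.exp (-(n * ε * Real.log q)) := by
          gcongr
          exact poly_factor_le hδ hq2 hn hK
      _ = _ := by
          rw [Real.rpow_def_of_pos (by linarith), Real.rpow_def_of_pos (by linarith),
            ← Real.exp_add]
          congr 1
          ring
  have hmeas : MeasurableSet G := (Set.toFinite _).measurableSet
  have := probReal_compl_eq_one_sub (μ := coordLaw m n) hmeas
  have hP : probListDecodable n ρ L D = (coordLaw m n).real G := rfl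
  rw [hP]
  linarith

end Probability

/-! ### Entropy of sets of vectors, and linear algebra. -/

section SetEntropy

theorem filter_split {F : Type*} [DecidableEq F] {n : ℕ} (S : Finset (Fin n → F)) (i : Fin n) (a : F) :
    ((S.filter fun v => v i = a : Finset (Fin n → F)) : Set (Fin n → F))
      ∪ (S.filter fun v => ¬ v i = a : Finset (Fin n → F)) = S := by
  rw [← Finset.coe_union, Finset.filter_union_filter_not_eq]

theorem eq_of_ne_of_ne_of_card_eq_two {F : Type*} [Fintype F] [DecidableEq F]
    (hF : Fintype.card F = 2) {a b c : F} (ha : a ≠ c)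
    (hb : b ≠ c) : a = b := by
  by_contra hab
  have h : ({a, b, c} : Finset F).card ≤ 2 := hF ▸ Finset.card_le_univ _
  rw [Finset.card_eq_three.2 ⟨a, b, c, hab, ha, hb, rfl⟩] at h
  omega

/-- The entropy of the joint law of the vectors in `S` at a uniform coordinate. -/
noncomputable def setEnt {F : Type*} {n : ℕ} (S : Set (Fin n → F)) : ℝ :=
  ent (fun (t : Fin n) (v : S) => (v : Fin n → F) t)

theorem setEnt_nonneg {F : Type*} {n : ℕ} (S : Set (Fin n → F)) : 0 ≤ setEnt S := by
  refine div_nonneg (Finset.sum_nonneg fun i _ => ?_) (Nat.cast_nonneg _)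
  have h1 : (0 : ℝ) < fibreCard (fun (t : Fin n) (v : S) => (v : Fin n → F) t) i := by
    exact_mod_cast fibreCard_pos _ i
  refine sub_nonneg.2 (Real.log_le_log h1 ?_)
  exact_mod_cast Finset.card_le_univ _

variable {F : Type*} [Field F] {n : ℕ}

theorem eq_at_of_mem_span {S : Set (Fin n → F)} {i j : Fin n} (h : ∀ v ∈ S, v i = v j)
    {v : Fin n → F} (hv : v ∈ Submodule.span F S) : v i = v j := by
  induction hv using Submodule.span_induction with
  | mem x hx => exact h x hx
  | zero => rfl
  | add x y _ _ hx hy => simp [hx, hy]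
  | smul a x _ hx => simp [hx]

/-- Two coordinates that agree on `T` agree on its span by linearity. So entropy ignores the
difference between a set and its span. -/
theorem setEnt_mono {S T : Set (Fin n → F)} (h : S ⊆ Submodule.span F T) :
    setEnt S ≤ setEnt T := by
  refine ent_mono fun i j hij => funext fun v => ?_
  exact eq_at_of_mem_span (fun w hw => congrFun hij ⟨w, hw⟩) (h v.2)

theorem setEnt_range {F : Type*} {n : ℕ} {κ : Type*} (u : κ → Fin n → F) :
    setEnt (Set.range u) = ent fun t j => u j t := by
  refine ent_congr fun i j => ⟨fun h => ?_, fun h => ?_⟩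
  · exact funext fun ⟨v, k, hk⟩ => by subst hk; exact congrFun h k
  · exact funext fun k => congrFun h ⟨u k, k, rfl⟩

theorem setEnt_union_add_le {S T I : Set (Fin n → F)} (hS : I ⊆ Submodule.span F S)
    (hT : I ⊆ Submodule.span F T) : setEnt (S ∪ T) + setEnt I ≤ setEnt S + setEnt T := by
  have h := ent_pair_add_le (fun (t : Fin n) (v : S) => (v : Fin n → F) t)
    (fun (t : Fin n) (v : T) => (v : Fin n → F) t) (fun (t : Fin n) (v : I) => (v : Fin n → F) t)
    (fun i j hij => funext fun v => eq_at_of_mem_span (fun w hw => congrFun hij ⟨w, hw⟩) (hS v.2))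
    (fun i j hij => funext fun v => eq_at_of_mem_span (fun w hw => congrFun hij ⟨w, hw⟩) (hT v.2))
  refine le_trans (add_le_add_left (le_of_eq ?_) _) h
  refine ent_congr fun i j => ⟨fun h => ?_, fun h => ?_⟩
  · simp only [Prod.mk.injEq] at h
    funext ⟨v, hv⟩
    rcases hv with hv | hv
    · exact congrFun h.1 ⟨v, hv⟩
    · exact congrFun h.2 ⟨v, hv⟩
  · simp only [Prod.mk.injEq]
    exact ⟨funext fun v => congrFun h ⟨v, Or.inl v.2⟩, funext fun v => congrFun h ⟨v, Or.inr v.2⟩⟩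

theorem setEnt_sup_le (I J : Submodule F (Fin n → F)) :
    setEnt ((I ⊔ J : Submodule F (Fin n → F)) : Set (Fin n → F))
      ≤ setEnt (I : Set (Fin n → F)) + setEnt (J : Set (Fin n → F)) := by
  have h := setEnt_union_add_le (S := (I : Set (Fin n → F))) (T := (J : Set (Fin n → F)))
    (I := ∅) (Set.empty_subset _) (Set.empty_subset _)
  have h2 : setEnt ((I ⊔ J : Submodule F (Fin n → F)) : Set (Fin n → F))
      ≤ setEnt ((I : Set (Fin n → F)) ∪ J) := by
    refine setEnt_mono ?_
    rw [Submodule.span_union, Submodule.span_eq, Submodule.span_eq]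
  linarith [setEnt_nonneg (∅ : Set (Fin n → F))]

theorem vectorSpan_le_span (S : Set (Fin n → F)) : vectorSpan F S ≤ Submodule.span F S := by
  rw [vectorSpan_def, Submodule.span_le]
  rintro _ ⟨x, hx, y, hy, rfl⟩
  exact Submodule.sub_mem _ (Submodule.subset_span hx) (Submodule.subset_span hy)

theorem vectorSpan_apply_eq_zero {S : Set (Fin n → F)} {i : Fin n}
    (h : ∀ x ∈ S, ∀ y ∈ S, x i = y i) {v : Fin n → F} (hv : v ∈ vectorSpan F S) : v i = 0 := by
  have : vectorSpan F S ≤ LinearMap.ker (LinearMap.proj i : (Fin n → F) →ₗ[F] F) := by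
    rw [vectorSpan_def, Submodule.span_le]
    rintro _ ⟨x, hx, y, hy, rfl⟩
    simpa [sub_eq_zero] using h x hx y hy
  simpa using this hv

/-- Gluing entropy bounds along two parallel hyperplanes. -/
theorem setEnt_union_le_of_parallel {S T : Finset (Fin n → F)} {θ h : ℝ} (hθ : 0 ≤ θ)
    {i : Fin n} (hS : ∀ x ∈ S, ∀ y ∈ S, x i = y i) (hT : ∀ x ∈ T, ∀ y ∈ T, x i = y i)
    {s t : Fin n → F} (hs : s ∈ S) (ht : t ∈ T) (hst : s i ≠ t i)
    (bS : setEnt (S : Set (Fin n → F))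
      ≤ (Module.finrank F (vectorSpan F (S : Set (Fin n → F))) + 1) * θ - (θ - h) * S.card)
    (bT : setEnt (T : Set (Fin n → F))
      ≤ (Module.finrank F (vectorSpan F (T : Set (Fin n → F))) + 1) * θ - (θ - h) * T.card)
    (bI : θ * Module.finrank F (vectorSpan F (S : Set (Fin n → F)) ⊓
        vectorSpan F (T : Set (Fin n → F)) : Submodule F (Fin n → F))
      ≤ setEnt ((vectorSpan F (S : Set (Fin n → F)) ⊓ vectorSpan F (T : Set (Fin n → F)) :
          Submodule F (Fin n → F)) : Set (Fin n → F))) :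
    setEnt ((S : Set (Fin n → F)) ∪ T)
      ≤ (Module.finrank F (vectorSpan F ((S : Set (Fin n → F)) ∪ T)) + 1) * θ
        - (θ - h) * (S.card + T.card) := by
  set A := vectorSpan F (S : Set (Fin n → F)) with hA
  set B := vectorSpan F (T : Set (Fin n → F)) with hB
  set V := vectorSpan F ((S : Set (Fin n → F)) ∪ T) with hV
  have hsub := setEnt_union_add_le (S := (S : Set (Fin n → F))) (T := (T : Set (Fin n → F)))
    (I := ((A ⊓ B : Submodule F (Fin n → F)) : Set (Fin n → F)))
    (fun x hx => vectorSpan_le_span _ hx.1) (fun x hx => vectorSpan_le_span _ hx.2)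
  -- Both direction spaces vanish at `i`, whereas `s - t` does not. The dimension gained compensates
  -- for adding the two `+ 1` terms.
  have hlt : A ⊔ B < V := by
    refine lt_of_le_of_ne (sup_le (vectorSpan_mono F Set.subset_union_left)
      (vectorSpan_mono F Set.subset_union_right)) fun heq => ?_
    have hmem : s - t ∈ A ⊔ B := by
      rw [heq]
      exact vsub_mem_vectorSpan F (Or.inl hs) (Or.inr ht)
    have hker : A ⊔ B ≤ LinearMap.ker (LinearMap.proj i : (Fin n → F) →ₗ[F] F) :=
      sup_le (fun v hv => by simpa using vectorSpan_apply_eq_zero hS hv)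
        (fun v hv => by simpa using vectorSpan_apply_eq_zero hT hv)
    have := hker hmem
    simp [sub_eq_zero] at this
    exact hst this
  have hdim := Submodule.finrank_lt_finrank_of_lt hlt
  have hsum := Submodule.finrank_sup_add_finrank_inf_eq A B
  have h1 : (Module.finrank F A : ℝ) + Module.finrank F B + 1
      ≤ Module.finrank F V + Module.finrank F (A ⊓ B : Submodule F (Fin n → F)) := by
    exact_mod_cast (by omega)
  have h2 := mul_le_mul_of_nonneg_left h1 hθ
  linarith

/-! ### The binary case: cutting along coordinates. -/

section Binary

variable [Fintype F] [DecidableEq F]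

/-- Over two elements a coordinate has just two slices, so they cover `S`. Their direction spaces
vanish at `i`, hence lower bounds are needed only for such subspaces `I`. -/
theorem setEnt_split_le (hF : Fintype.card F = 2) {S : Finset (Fin n → F)} {θ h : ℝ} (hθ : 0 ≤ θ)
    {i : Fin n} {s t : Fin n → F} (hs : s ∈ S) (ht : t ∈ S) (hst : t i ≠ s i)
    (b : ∀ T ⊂ S, T.Nonempty → (∀ x ∈ T, ∀ y ∈ T, x i = y i) →
      setEnt (T : Set (Fin n → F))
        ≤ (Module.finrank F (vectorSpan F (T : Set (Fin n → F))) + 1) * θ - (θ - h) * T.card)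
    (bI : ∀ I ≤ vectorSpan F (S : Set (Fin n → F)), (∀ v ∈ I, v i = 0) →
      θ * Module.finrank F I ≤ setEnt (I : Set (Fin n → F))) :
    setEnt (S : Set (Fin n → F))
      ≤ (Module.finrank F (vectorSpan F (S : Set (Fin n → F))) + 1) * θ - (θ - h) * S.card := by
  have hs' : s ∈ S.filter fun v => v i = s i := by simp [hs]
  have ht' : t ∈ S.filter fun v => ¬ v i = s i := by simp [ht, hst]
  have h0 : ∀ x ∈ S.filter fun v => v i = s i, ∀ y ∈ S.filter fun v => v i = s i, x i = y i := by
    intro x hx y hy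
    rw [(Finset.mem_filter.mp hx).2, (Finset.mem_filter.mp hy).2]
  have h1 : ∀ x ∈ S.filter fun v => ¬ v i = s i, ∀ y ∈ S.filter fun v => ¬ v i = s i,
      x i = y i := by
    intro x hx y hy
    exact eq_of_ne_of_ne_of_card_eq_two hF (Finset.mem_filter.mp hx).2 (Finset.mem_filter.mp hy).2
  have hsub0 : S.filter (fun v => v i = s i) ⊂ S :=
    Finset.filter_ssubset.2 ⟨t, ht, hst⟩
  have hsub1 : S.filter (fun v => ¬ v i = s i) ⊂ S :=
    Finset.filter_ssubset.2 ⟨s, hs, by simp⟩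
  have key := setEnt_union_le_of_parallel hθ h0 h1 hs' ht' (Ne.symm hst)
    (b _ hsub0 ⟨s, hs'⟩ h0) (b _ hsub1 ⟨t, ht'⟩ h1)
    (bI _ (inf_le_left.trans (vectorSpan_mono F (Finset.coe_subset.2 hsub0.subset)))
      fun v hv => vectorSpan_apply_eq_zero h0 hv.1)
  rw [filter_split] at key
  have hc : ((S.filter fun v => v i = s i).card : ℝ) + (S.filter fun v => ¬ v i = s i).card
      = S.card := by
    exact_mod_cast Finset.card_filter_add_card_filter_not (s := S) (fun v => v i = s i)
  rwa [hc] at key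

/-- Induction by cutting at any nonconstant coordinate. For a singleton the bound reads `θ - (θ - h)
= h`. -/
theorem setEnt_le_of_forall_le_vectorSpan (hF : Fintype.card F = 2) {θ h : ℝ} (hθ : 0 ≤ θ)
    (S : Finset (Fin n → F)) (hne : S.Nonempty) (hS : ∀ v ∈ S, setEnt {v} ≤ h)
    (bI : ∀ I ≤ vectorSpan F (S : Set (Fin n → F)),
      θ * Module.finrank F I ≤ setEnt (I : Set (Fin n → F))) :
    setEnt (S : Set (Fin n → F))
      ≤ (Module.finrank F (vectorSpan F (S : Set (Fin n → F))) + 1) * θ - (θ - h) * S.card := by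
  induction S using Finset.strongInduction with
  | H S ih =>
    by_cases hsub : (S : Set (Fin n → F)).Subsingleton
    · obtain ⟨v, hv⟩ := hne
      have hSv : S = {v} := by
        ext w
        rw [Finset.mem_singleton]
        exact ⟨fun hw => hsub hw hv, fun hw => hw ▸ hv⟩
      subst hSv
      have := hS v (Finset.mem_singleton_self v)
      have h0 : vectorSpan F (({v} : Finset (Fin n → F)) : Set (Fin n → F)) = ⊥ := by simp
      rw [h0, finrank_bot, Finset.card_singleton, Finset.coe_singleton]
      push_cast
      linarith
    · rw [Set.not_subsingleton_iff] at hsub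
      obtain ⟨s, hs, t, ht, hst⟩ := hsub
      obtain ⟨i, hi⟩ := Function.ne_iff.mp hst
      refine setEnt_split_le hF hθ hs ht (Ne.symm hi) (fun T hT hTne _ => ?_) fun I hI _ => bI I hI
      exact ih T hT hTne (fun v hv => hS v (hT.subset hv)) fun I hI =>
        bI I (hI.trans (vectorSpan_mono F (Finset.coe_subset.2 hT.subset)))

/-- It suffices to control the entropy of subspaces of dimension at least two. -/
theorem setEnt_le_of_forall_two_le_finrank (hF : Fintype.card F = 2) {θ h : ℝ} (hθ : 0 ≤ θ)
    (S : Finset (Fin n → F)) (hne : S.Nonempty) (hS : ∀ v ∈ S, setEnt {v} ≤ h)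
    (bI : ∀ I ≤ vectorSpan F (S : Set (Fin n → F)), 2 ≤ Module.finrank F I →
      θ * Module.finrank F I ≤ setEnt (I : Set (Fin n → F))) :
    setEnt (S : Set (Fin n → F))
      ≤ (Module.finrank F (vectorSpan F (S : Set (Fin n → F))) + 1) * θ - (θ - h) * S.card := by
  by_cases hall : ∀ I ≤ vectorSpan F (S : Set (Fin n → F)),
      θ * Module.finrank F I ≤ setEnt (I : Set (Fin n → F))
  · exact setEnt_le_of_forall_le_vectorSpan hF hθ S hne hS hall
  push Not at hall
  obtain ⟨I₀, hI₀, hlow⟩ := hall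
  have hI₀1 : Module.finrank F I₀ = 1 := by
    by_contra h1
    rcases Nat.lt_or_ge (Module.finrank F I₀) 2 with h2 | h2
    · have h0 : Module.finrank F I₀ = 0 := by omega
      rw [h0] at hlow
      have := setEnt_nonneg (I₀ : Set (Fin n → F))
      simp at hlow
      linarith
    · exact absurd (bI I₀ hI₀ h2) (not_le.2 hlow)
  obtain ⟨d, hd, hd0⟩ : ∃ d ∈ I₀, d ≠ 0 := by
    refine I₀.exists_mem_ne_zero_of_ne_bot ?_
    rintro rfl
    simp at hI₀1
  obtain ⟨i, hi⟩ := Function.ne_iff.mp hd0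
  -- Cutting at a coordinate where the bad line `I₀` is nonzero repairs everything: a line `I`
  -- vanishing there spans a plane with `I₀`, the plane has entropy at least `2θ`, and `I₀` accounts
  -- for less than `θ` of it.
  have good : ∀ I ≤ vectorSpan F (S : Set (Fin n → F)), (∀ v ∈ I, v i = 0) →
      θ * Module.finrank F I ≤ setEnt (I : Set (Fin n → F)) := by
    intro I hI hIi
    rcases Nat.lt_or_ge (Module.finrank F I) 2 with h2 | h2
    · rcases Nat.eq_zero_or_pos (Module.finrank F I) with h0 | h0
      · rw [h0]
        simpa using setEnt_nonneg (I : Set (Fin n → F))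
      · have hI1 : Module.finrank F I = 1 := by omega
        have hinf : Module.finrank F (I₀ ⊓ I : Submodule F (Fin n → F)) < 1 := by
          rw [← hI₀1]
          refine Submodule.finrank_lt_finrank_of_lt (lt_of_le_of_ne inf_le_left fun heq => ?_)
          have : d ∈ I₀ ⊓ I := by rw [heq]; exact hd
          exact hi (hIi d this.2)
        have hsum := Submodule.finrank_sup_add_finrank_inf_eq I₀ I
        have hsup : Module.finrank F (I₀ ⊔ I : Submodule F (Fin n → F)) = 2 := by omega
        have h3 := bI (I₀ ⊔ I) (sup_le hI₀ hI) hsup.ge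
        have h4 := setEnt_sup_le I₀ I
        rw [hsup] at h3
        rw [hI₀1] at hlow
        rw [hI1]
        push_cast at h3 hlow ⊢
        linarith
    · exact bI I hI h2
  have hex : ∃ s ∈ S, ∃ t ∈ S, t i ≠ s i := by
    by_contra hcon
    push Not at hcon
    exact hi (vectorSpan_apply_eq_zero (fun x hx y hy => hcon y hy x hx) (hI₀ hd))
  obtain ⟨s, hs, t, ht, hst⟩ := hex
  refine setEnt_split_le hF hθ hs ht hst (fun T hT hTne hTi => ?_) good
  exact setEnt_le_of_forall_le_vectorSpan hF hθ T hTne (fun v hv => hS v (hT.subset hv))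
    fun I hI => good I (hI.trans (vectorSpan_mono F (Finset.coe_subset.2 hT.subset)))
      fun v hv => vectorSpan_apply_eq_zero hTi (hI hv)

end Binary

end SetEntropy

/-! ### Chains of nearly independent combinations. -/

section Chains

/-- Under a product law, swapping coordinate `i` with a fresh independent copy preserves the
measure. -/
theorem sum_prod_resample {F κ : Type*} [Fintype F] [Fintype κ] [DecidableEq κ] (ν : F → ℝ) (hν : ∑ s, ν s = 1) (X : (κ → F) → ℝ) (i : κ) :
    ∑ f : κ → F, (∏ k, ν (f k)) * X f
      = ∑ f : κ → F, (∏ k, ν (f k)) * ∑ s, ν s * X (Function.update f i s) := by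
  have hinv : Function.Involutive
      fun p : (κ → F) × F => (Function.update p.1 i p.2, p.1 i) := by
    rintro ⟨f, s⟩
    simp
  have hprod : ∀ (f : κ → F) s, (∏ k, ν (Function.update f i s k)) * ν (f i)
      = (∏ k, ν (f k)) * ν s := by
    intro f s
    rw [← Finset.mul_prod_erase _ _ (Finset.mem_univ i),
      ← Finset.mul_prod_erase _ (fun k => ν (f k)) (Finset.mem_univ i), Function.update_self]
    have : ∏ k ∈ Finset.univ.erase i, ν (Function.update f i s k)
        = ∏ k ∈ Finset.univ.erase i, ν (f k) :=
      Finset.prod_congr rfl fun k hk => by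
        rw [Function.update_of_ne (Finset.ne_of_mem_erase hk)]
    rw [this]
    ring
  calc ∑ f : κ → F, (∏ k, ν (f k)) * X f
      = ∑ p : (κ → F) × F, (∏ k, ν (p.1 k)) * ν p.2 * X p.1 := by
        rw [Fintype.sum_prod_type]
        refine Finset.sum_congr rfl fun f _ => ?_
        dsimp only
        rw [← Finset.sum_mul, ← Finset.mul_sum, hν, mul_one]
    _ = ∑ p : (κ → F) × F, (∏ k, ν (p.1 k)) * ν p.2 * X (Function.update p.1 i p.2) := by
        rw [← Equiv.sum_comp hinv.toPerm]
        refine Finset.sum_congr rfl fun p _ => ?_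
        simp only [Function.Involutive.coe_toPerm]
        rw [hprod]
    _ = _ := by
        rw [Fintype.sum_prod_type]
        refine Finset.sum_congr rfl fun f _ => ?_
        rw [Finset.mul_sum]
        exact Finset.sum_congr rfl fun s _ => by ring

theorem sum_mul_update {F κ : Type*} [Field F] [Fintype κ] [DecidableEq κ] (v f : κ → F) (i : κ) (s : F) :
    ∑ k, v k * Function.update f i s k = v i * s + (∑ k, v k * f k - v i * f i) := by
  rw [← Finset.add_sum_erase _ _ (Finset.mem_univ i),
    ← Finset.add_sum_erase _ (fun k => v k * f k) (Finset.mem_univ i), Function.update_self,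
    add_sub_cancel_left]
  congr 1
  exact Finset.sum_congr rfl fun k hk => by
    rw [Function.update_of_ne (Finset.ne_of_mem_erase hk)]

/-- Resampling only `f i` and `f j` leaves `R` fixed while averaging `G` over a combination of two
independent symbols. This is how one link of a chain splits off. -/
theorem sum_prod_mul_le {F κ : Type*} [Fintype F] [Field F] [Fintype κ] [DecidableEq κ]
    {ν : F → ℝ} (hν0 : ∀ s, 0 ≤ ν s) (hν : ∑ s, ν s = 1) {G : F → ℝ} {μ : ℝ}
    (hG : ∀ c c' y, c ≠ 0 → c' ≠ 0 → ∑ s', ν s' * ∑ s, ν s * G (c * s + c' * s' + y) ≤ μ)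
    {v : κ → F} {i j : κ} (hij : i ≠ j) (hi : v i ≠ 0) (hj : v j ≠ 0) {R : (κ → F) → ℝ}
    (hR : ∀ f, 0 ≤ R f) (hRi : ∀ f s, R (Function.update f i s) = R f)
    (hRj : ∀ f s, R (Function.update f j s) = R f) (y : F) :
    ∑ f : κ → F, (∏ k, ν (f k)) * (G (∑ k, v k * f k + y) * R f)
      ≤ μ * ∑ f : κ → F, (∏ k, ν (f k)) * R f := by
  rw [sum_prod_resample ν hν _ i, sum_prod_resample ν hν _ j, Finset.mul_sum]
  refine Finset.sum_le_sum fun f _ => ?_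
  have hp : 0 ≤ ∏ k, ν (f k) := Finset.prod_nonneg fun k _ => hν0 _
  have key : ∑ s', ν s' * ∑ s, ν s * (G (∑ k, v k * Function.update (Function.update f j s') i s k
        + y) * R (Function.update (Function.update f j s') i s))
      = (∑ s', ν s' * ∑ s, ν s * G (v i * s + v j * s' +
          (∑ k, v k * f k - v j * f j - v i * f i + y))) * R f := by
    rw [Finset.sum_mul]
    refine Finset.sum_congr rfl fun s' _ => ?_
    rw [mul_assoc, Finset.sum_mul]
    congr 1
    refine Finset.sum_congr rfl fun s _ => ?_
    rw [hRi, hRj, sum_mul_update, sum_mul_update, Function.update_of_ne hij, mul_assoc]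
    congr 3
    ring
  rw [key]
  calc _ ≤ (∏ k, ν (f k)) * (μ * R f) := by
        gcongr
        · exact hR f
        · exact hG _ _ _ hi hj
    _ = _ := by ring

variable {F κ : Type*} [Fintype F] [DecidableEq F] [Fintype κ] [DecidableEq κ]

/-- A vector with `x i = t ≠ s` must have `x j = s'`. The pair `(t, s')` cannot be popular, since
`b` has `b i = s` and `b j ≠ s'`. Summing over `t` leaves at most a fraction `1 / (4q)` of `A`. -/
theorem two_mul_card_ne_lt {F κ : Type*} [Fintype F] [DecidableEq F] {A : Finset (κ → F)}
    (H : ∀ i j, i ≠ j → ∀ s s',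
      A.card ≤ 4 * Fintype.card F ^ 2 * (A.filter fun x => x i = s ∧ x j = s').card →
      ∀ a ∈ A, a i = s ∨ a j = s')
    {i j : κ} (hij : i ≠ j) {s s' : F} (hcross : ∀ a ∈ A, a i = s ∨ a j = s')
    {b : κ → F} (hb : b ∈ A) (hbj : b j ≠ s') :
    2 * (A.filter fun x => x i ≠ s).card < A.card := by
  set q := Fintype.card F with hq
  have hq0 : 0 < q := Fintype.card_pos_iff.2 ⟨s⟩
  have hA : 0 < A.card := Finset.card_pos.2 ⟨b, hb⟩
  have hsmall : ∀ t, t ≠ s → 4 * q ^ 2 * (A.filter fun x => x i = t ∧ x j = s').card < A.card := by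
    intro t ht
    by_contra hcon
    have h1 := H i j hij t s' (not_lt.1 hcon) b hb
    have h2 := hcross b hb
    rcases h1 with h1 | h1
    · rcases h2 with h2 | h2
      · exact ht (h1.symm.trans h2)
      · exact hbj h2
    · exact hbj h1
  have hle : (A.filter fun x => x i ≠ s).card
      ≤ ∑ t ∈ Finset.univ.erase s, (A.filter fun x => x i = t ∧ x j = s').card := by
    rw [Finset.card_eq_sum_card_fiberwise (f := fun x : κ → F => x i) (t := Finset.univ.erase s)]
    · refine Finset.sum_le_sum fun t ht => Finset.card_le_card fun x hx => ?_
      simp only [Finset.mem_filter] at hx ⊢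
      exact ⟨hx.1.1, hx.2, (hcross x hx.1.1).resolve_left hx.1.2⟩
    · intro x hx
      simpa using (Finset.mem_filter.mp hx).2
  have hsum : ∑ t ∈ Finset.univ.erase s, 4 * q ^ 2 * (A.filter fun x => x i = t ∧ x j = s').card
      ≤ q * A.card := by
    calc _ ≤ ∑ t ∈ Finset.univ.erase s, A.card :=
          Finset.sum_le_sum fun t ht => (hsmall t (Finset.ne_of_mem_erase ht)).le
      _ = (Finset.univ.erase s).card * A.card := by rw [Finset.sum_const, smul_eq_mul]
      _ ≤ _ := Nat.mul_le_mul_right _ (Finset.card_le_univ _)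
  rw [← Finset.mul_sum] at hsum
  have h3 : 4 * q ^ 2 * (A.filter fun x => x i ≠ s).card ≤ q * A.card :=
    (Nat.mul_le_mul_left _ hle).trans hsum
  have h4 : 4 * q * (A.filter fun x => x i ≠ s).card ≤ A.card :=
    Nat.le_of_mul_le_mul_left (by linarith [h3] : q * (4 * q * _) ≤ q * A.card) hq0
  nlinarith

/-- In a large set of vectors, some vector disagrees in two coordinates with a popular pair of
values. -/
theorem exists_popular_pair {A : Finset (κ → F)}
    (hA : 1 + Fintype.card F * Fintype.card κ < A.card) :
    ∃ i j, i ≠ j ∧ ∃ s s', ∃ a ∈ A, a i ≠ s ∧ a j ≠ s' ∧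
      A.card ≤ 4 * Fintype.card F ^ 2 * (A.filter fun x => x i = s ∧ x j = s').card := by
  by_contra hcon
  have H : ∀ i j, i ≠ j → ∀ s s',
      A.card ≤ 4 * Fintype.card F ^ 2 * (A.filter fun x => x i = s ∧ x j = s').card →
      ∀ a ∈ A, a i = s ∨ a j = s' := by
    intro i j hij s s' hle a ha
    by_contra h
    push Not at h
    exact hcon ⟨i, j, hij, s, s', a, ha, h.1, h.2, hle⟩
  obtain ⟨a₀, ha₀⟩ : A.Nonempty := Finset.card_pos.1 (by omega)
  have hmax : ∀ i : κ, ∃ s : F, ∀ t : F,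
      (A.filter fun x => x i = t).card ≤ (A.filter fun x => x i = s).card := by
    intro i
    obtain ⟨s, -, hs⟩ := Finset.exists_max_image (Finset.univ : Finset F)
      (fun t => (A.filter fun x => x i = t).card) ⟨a₀ i, Finset.mem_univ _⟩
    exact ⟨s, fun t => hs t (Finset.mem_univ t)⟩
  choose m hm using hmax
  have hmem : ∀ i, ∃ b ∈ A, b i = m i := by
    intro i
    have h1 : 0 < (A.filter fun x => x i = a₀ i).card :=
      Finset.card_pos.2 ⟨a₀, by simp [ha₀]⟩
    obtain ⟨b, hb⟩ := Finset.card_pos.1 (h1.trans_le (hm i (a₀ i)))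
    exact ⟨b, (Finset.mem_filter.mp hb).1, (Finset.mem_filter.mp hb).2⟩
  have huniq : ∀ i s, 2 * (A.filter fun x => x i ≠ s).card < A.card → s = m i := by
    intro i s hs
    by_contra hne
    have h1 := Finset.card_filter_add_card_filter_not (s := A) (fun x => x i = s)
    have h2 : (A.filter fun x => x i = m i).card ≤ (A.filter fun x => x i ≠ s).card :=
      Finset.card_le_card fun x hx => by
        simp only [Finset.mem_filter] at hx ⊢
        exact ⟨hx.1, fun h => hne (h.symm.trans hx.2)⟩
    have h3 := hm i s
    have h4 : (A.filter fun x => ¬ x i = s).card = (A.filter fun x => x i ≠ s).card := rfl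
    omega
  -- If `a` left the plurality vector `m` at both `i` and `j`, a pigeonhole pair `(s, s')` would be
  -- popular, hence met by all of `A` in one coordinate; neither coordinate being constant, `s` and
  -- `s'` are majority values, so equal `m i` and `m j`, and `a` misses both. Thus `A` lies within
  -- distance one of `m`.
  have hpair : ∀ i j, i ≠ j → ∀ a ∈ A, a i = m i ∨ a j = m j := by
    intro i j hij a ha
    by_contra hne
    push Not at hne
    obtain ⟨⟨s, s'⟩, hss⟩ : ∃ p : F × F, A.card ≤ Fintype.card F ^ 2 *
        (A.filter fun x => x i = p.1 ∧ x j = p.2).card := by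
      by_contra hall
      push Not at hall
      have h1 : A.card = ∑ p : F × F, (A.filter fun x => x i = p.1 ∧ x j = p.2).card := by
        rw [Finset.card_eq_sum_card_fiberwise (f := fun x : κ → F => (x i, x j))
          (t := Finset.univ) (by simp)]
        refine Finset.sum_congr rfl fun p _ => ?_
        congr 1
        ext x
        simp [Prod.ext_iff]
      have h2 : ∑ p : F × F, Fintype.card F ^ 2 *
          (A.filter fun x => x i = p.1 ∧ x j = p.2).card < ∑ _p : F × F, A.card :=
        Finset.sum_lt_sum_of_nonempty ⟨(a i, a j), Finset.mem_univ _⟩ fun p _ => hall p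
      rw [← Finset.mul_sum, ← h1, Finset.sum_const, Finset.card_univ, Fintype.card_prod,
        smul_eq_mul, pow_two] at h2
      exact lt_irrefl _ h2
    have hcross := H i j hij s s' (hss.trans (by nlinarith))
    have hcross' : ∀ a ∈ A, a j = s' ∨ a i = s := fun a ha => (hcross a ha).symm
    have nonconst : ∀ k, a k ≠ m k → ∀ t, ∃ b ∈ A, b k ≠ t := by
      intro k hk t
      by_cases hat : a k = t
      · obtain ⟨b, hb, hbk⟩ := hmem k
        exact ⟨b, hb, fun h => hk (hat.trans (h.symm.trans hbk))⟩
      · exact ⟨a, ha, hat⟩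
    obtain ⟨b, hb, hbj⟩ := nonconst j hne.2 s'
    obtain ⟨c, hc, hci⟩ := nonconst i hne.1 s
    have e1 := huniq i s (two_mul_card_ne_lt H hij hcross hb hbj)
    have e2 := huniq j s' (two_mul_card_ne_lt H hij.symm hcross' hc hci)
    rcases hcross a ha with h | h
    · exact hne.1 (h.trans e1)
    · exact hne.2 (h.trans e2)
  have hsub : A ⊆ Finset.univ.image fun o : Option (F × κ) =>
      o.elim m fun p => Function.update m p.2 p.1 := by
    intro a ha
    rw [Finset.mem_image]
    by_cases h : a = m
    · exact ⟨none, Finset.mem_univ _, h.symm⟩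
    · obtain ⟨i, hi⟩ := Function.ne_iff.mp h
      refine ⟨some (a i, i), Finset.mem_univ _, ?_⟩
      funext j
      by_cases hji : j = i
      · subst hji; simp
      · simp only [Option.elim_some, Function.update_of_ne hji]
        exact (((hpair i j (Ne.symm hji) a ha).resolve_left hi)).symm
  have := (Finset.card_le_card hsub).trans Finset.card_image_le
  rw [Finset.card_univ, Fintype.card_option, Fintype.card_prod] at this
  omega

variable [Field F]

/-- A large set of coefficient vectors contains `d` vectors whose values, up to a common shift,
are nearly independent. -/
theorem exists_chain {ν : F → ℝ} (hν0 : ∀ s, 0 ≤ ν s) (hν : ∑ s, ν s = 1) {G : F → ℝ} {μ : ℝ}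
    (hG0 : ∀ x, 0 ≤ G x) (hμ : 0 ≤ μ)
    (hG : ∀ c c' y, c ≠ 0 → c' ≠ 0 → ∑ s', ν s' * ∑ s, ν s * G (c * s + c' * s' + y) ≤ μ)
    (d : ℕ) (A : Finset (κ → F))
    (hA : (4 * Fintype.card F ^ 2) ^ d * (1 + Fintype.card F * Fintype.card κ) < A.card) :
    ∃ w : κ → F, (∀ i s, (∀ a ∈ A, a i = s) → w i = s) ∧ ∃ l : Fin d → κ → F, (∀ r, l r ∈ A) ∧
      ∀ y, ∑ f : κ → F, (∏ k, ν (f k)) * ∏ r, G (∑ k, (l r k - w k) * f k + y) ≤ μ ^ d := by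
  induction d generalizing A with
  | zero =>
    obtain ⟨a, ha⟩ : A.Nonempty := Finset.card_pos.1 (by omega)
    refine ⟨a, fun i s h => h a ha, fun r => r.elim0, fun r => r.elim0, fun y => ?_⟩
    have := Fintype.prod_sum fun (_ : κ) (x : F) => ν x
    simp [← this, hν]
  | succ d ih =>
    have hF : 0 < Fintype.card F := Fintype.card_pos
    have h1 : 1 + Fintype.card F * Fintype.card κ < A.card := by
      refine lt_of_le_of_lt ?_ hA
      exact Nat.le_mul_of_pos_left _ (by positivity)
    obtain ⟨i, j, hij, s, s', a, ha, hai, haj, hpop⟩ := exists_popular_pair h1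
    -- The rest of the chain and `w` have the values `s`, `s'` at `i`, `j`. So the later factors,
    -- taken relative to `w`, ignore `f i` and `f j`, while `a - w` involves both.
    set A' := A.filter fun x => x i = s ∧ x j = s' with hA'
    have h2 : (4 * Fintype.card F ^ 2) ^ d * (1 + Fintype.card F * Fintype.card κ) < A'.card := by
      have h3 := hA.trans_le hpop
      rw [pow_succ, mul_comm _ (4 * Fintype.card F ^ 2), mul_assoc] at h3
      exact Nat.lt_of_mul_lt_mul_left h3
    obtain ⟨w, hw, l, hl, hb⟩ := ih A' h2
    have hwi : w i = s := hw i s fun x hx => (Finset.mem_filter.mp hx).2.1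
    have hwj : w j = s' := hw j s' fun x hx => (Finset.mem_filter.mp hx).2.2
    refine ⟨w, fun k t h => hw k t fun x hx => h x (Finset.mem_filter.mp hx).1,
      Fin.cons a l, fun r => ?_, fun y => ?_⟩
    · refine Fin.cases ?_ (fun r => ?_) r
      · simpa using ha
      · simpa using (Finset.mem_filter.mp (hl r)).1
    · simp only [Fin.prod_univ_succ, Fin.cons_zero, Fin.cons_succ]
      have hinv : ∀ k, (∀ r, l r k = w k) → ∀ (f : κ → F) t,
          ∏ r, G (∑ k', (l r k' - w k') * Function.update f k t k' + y)
            = ∏ r, G (∑ k', (l r k' - w k') * f k' + y) := by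
        intro k hk f t
        refine Finset.prod_congr rfl fun r _ => ?_
        rw [sum_mul_update (fun k' => l r k' - w k'), hk r]
        simp
      refine (sum_prod_mul_le hν0 hν hG (v := fun k => a k - w k) hij
        (by rw [hwi]; exact sub_ne_zero.2 hai) (by rw [hwj]; exact sub_ne_zero.2 haj)
        (R := fun f => ∏ r, G (∑ k, (l r k - w k) * f k + y))
        (fun f => Finset.prod_nonneg fun r _ => hG0 _)
        (hinv i fun r => by rw [hwi]; exact (Finset.mem_filter.mp (hl r)).2.1)
        (hinv j fun r => by rw [hwj]; exact (Finset.mem_filter.mp (hl r)).2.2) y).trans ?_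
      rw [pow_succ, mul_comm _ μ]
      exact mul_le_mul_of_nonneg_left (hb y) hμ

end Chains

/-! ### Gibbs' inequality for low-weight vectors, plain and tilted. -/

section Weights

theorem sum_comp_eq {F : Type*} [DecidableEq F] [Field F] {n : ℕ} (v : Fin n → F) (a b : ℝ) :
    ∑ t, (if v t = 0 then a else b) = n * a + hammingNorm v * (b - a) := by
  have h : ∀ t, (if v t = 0 then a else b) = a + if v t ≠ 0 then b - a else 0 := by
    intro t
    by_cases hv : v t = 0 <;> simp [hv]
  rw [Finset.sum_congr rfl fun t _ => h t, Finset.sum_add_distrib, ← Finset.sum_filter,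
    Finset.sum_const, Finset.sum_const, nsmul_eq_mul, nsmul_eq_mul, Finset.card_univ,
    Fintype.card_fin]
  rfl

theorem hammingNorm_le_of_wt_le {F : Type*} [DecidableEq F] [Field F] {ρ : ℝ} {n : ℕ} (hn : 0 < n) {v : Fin n → F} (hv : wt v ≤ ρ) :
    (hammingNorm v : ℝ) ≤ n * ρ := by
  rw [wt, div_le_iff₀ (by exact_mod_cast hn)] at hv
  linarith

/-- The law on `F` that has mass `1 - ρ` at `0` and is uniform elsewhere. -/
noncomputable def ballLaw (q : ℕ) (ρ : ℝ) {F : Type*} [Zero F] [DecidableEq F] (x : F) : ℝ :=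
  if x = 0 then 1 - ρ else ρ / (q - 1)

variable {F : Type*} [Fintype F] [DecidableEq F] [Field F] {ρ : ℝ} {q : ℕ}

theorem two_le_card {F : Type*} [Fintype F] [Field F] {q : ℕ} (hq : q = Fintype.card F) : (2 : ℝ) ≤ q := by
  subst hq
  exact_mod_cast (Fintype.one_lt_card : 1 < Fintype.card F)

theorem lt_one_of_lt {q : ℕ} {ρ : ℝ} (h1 : ρ < 1 - 1 / (q : ℝ)) : ρ < 1 := by
  have : (0 : ℝ) ≤ 1 / (q : ℝ) := by positivity
  linarith

theorem mul_lt_of_lt {q : ℕ} {ρ : ℝ} (hq : (2 : ℝ) ≤ q) (h1 : ρ < 1 - 1 / (q : ℝ)) :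
    ρ < (1 - ρ) * (q - 1) := by
  have hq0 : (0 : ℝ) < q := by linarith
  have := mul_lt_mul_of_pos_right h1 hq0
  rw [sub_mul, one_mul, div_mul_cancel₀ _ hq0.ne'] at this
  linarith

theorem ballLaw_pos (hq : q = Fintype.card F) (h0 : 0 < ρ) (h1 : ρ < 1) (x : F) :
    0 < ballLaw q ρ x := by
  have := two_le_card hq
  unfold ballLaw
  split_ifs
  · linarith
  · exact div_pos h0 (by linarith)

theorem sum_ite_zero (hq : q = Fintype.card F) (a b : ℝ) :
    ∑ x : F, (if x = 0 then a else b) = a + (q - 1) * b := by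
  rw [← Finset.add_sum_erase _ _ (Finset.mem_univ (0 : F)), if_pos rfl]
  congr 1
  rw [Finset.sum_congr rfl (g := fun _ => b) fun x hx => if_neg (Finset.ne_of_mem_erase hx),
    Finset.sum_const, Finset.card_erase_of_mem (Finset.mem_univ _), Finset.card_univ, ← hq,
    nsmul_eq_mul, Nat.cast_sub (by rw [hq]; exact Fintype.card_pos)]
  simp

theorem sum_ballLaw (hq : q = Fintype.card F) : ∑ x : F, ballLaw q ρ x = 1 := by
  have h := two_le_card hq
  have h' : (q : ℝ) - 1 ≠ 0 := by linarith
  unfold ballLaw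
  rw [sum_ite_zero hq]
  field_simp
  ring

/-- The collision probability of `ballLaw`. -/
noncomputable def collision (q : ℕ) (ρ : ℝ) : ℝ := (1 - ρ) ^ 2 + ρ ^ 2 / (q - 1)

theorem sum_ballLaw_sq (hq : q = Fintype.card F) :
    ∑ x : F, ballLaw q ρ x ^ 2 = collision q ρ := by
  have h := two_le_card hq
  have h' : (q : ℝ) - 1 ≠ 0 := by linarith
  have : ∀ x : F, ballLaw q ρ x ^ 2 = if x = 0 then (1 - ρ) ^ 2 else (ρ / (q - 1)) ^ 2 := by
    intro x
    unfold ballLaw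
    split_ifs <;> rfl
  rw [Finset.sum_congr rfl fun x _ => this x, sum_ite_zero hq, collision]
  field_simp

theorem collision_pos (hq : (2 : ℝ) ≤ q) (h1 : ρ < 1) : 0 < collision q ρ := by
  have h2 : 0 < (1 - ρ) ^ 2 := by have : 0 < 1 - ρ := by linarith
                                  positivity
  have h3 : 0 ≤ ρ ^ 2 / ((q : ℝ) - 1) := div_nonneg (sq_nonneg _) (by linarith)
  unfold collision
  linarith

/-- The source of all gain: a low-weight vector is zero on a fraction at least `1 - ρ`, strictly
more than the chance that a combination of two independent symbols vanishes. -/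
theorem collision_lt (hq : (2 : ℝ) ≤ q) (h0 : 0 < ρ) (h1 : ρ < 1 - 1 / (q : ℝ)) :
    collision q ρ < 1 - ρ := by
  have hm := mul_lt_of_lt hq h1
  have h : ρ ^ 2 / ((q : ℝ) - 1) < ρ * (1 - ρ) := by
    rw [div_lt_iff₀ (by linarith)]
    nlinarith
  unfold collision
  nlinarith

/-- The tilt used to detect zeros: weight `1 + g` at zero and `1` elsewhere. -/
noncomputable def tilt (g : ℝ) (x : F) : ℝ := if x = 0 then 1 + g else 1

theorem sum_sum_tilt_le (hq : q = Fintype.card F) {g : ℝ} (hg : 0 ≤ g) (c c' y : F) (hc : c ≠ 0)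
    (hc' : c' ≠ 0) :
    ∑ s', ballLaw q ρ s' * ∑ s, ballLaw q ρ s * tilt g (c * s + c' * s' + y)
      ≤ 1 + g * collision q ρ := by
  have htilt : ∀ s' : F, ∑ s, ballLaw q ρ s * tilt g (c * s + c' * s' + y)
      = 1 + g * ballLaw q ρ (-(c' * s' + y) / c) := by
    intro s'
    have h1 : ∀ s : F, ballLaw q ρ s * tilt g (c * s + c' * s' + y)
        = ballLaw q ρ s + if s = -(c' * s' + y) / c then g * ballLaw q ρ s else 0 := by
      intro s
      have h2 : c * s + c' * s' + y = 0 ↔ s = -(c' * s' + y) / c := by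
        rw [eq_div_iff hc, mul_comm s c, eq_neg_iff_add_eq_zero, add_assoc]
      unfold tilt
      by_cases h : c * s + c' * s' + y = 0
      · rw [if_pos h, if_pos (h2.1 h)]; ring
      · rw [if_neg h, if_neg fun h3 => h (h2.2 h3)]; ring
    rw [Finset.sum_congr rfl fun s _ => h1 s, Finset.sum_add_distrib, sum_ballLaw hq,
      Finset.sum_ite_eq' Finset.univ, if_pos (Finset.mem_univ _)]
  have hbij : Function.Bijective fun s' : F => -(c' * s' + y) / c := by
    refine Finite.injective_iff_bijective.1 fun a b h => ?_
    have h1 := (div_left_inj' hc).1 h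
    have h2 := add_right_cancel (neg_injective h1)
    exact mul_left_cancel₀ hc' h2
  have hsq : ∑ s' : F, ballLaw q ρ (-(c' * s' + y) / c) ^ 2 = collision q ρ := by
    rw [← sum_ballLaw_sq hq]
    exact hbij.sum_comp fun x => ballLaw q ρ x ^ 2
  calc _ = ∑ s' : F, (ballLaw q ρ s' + g * (ballLaw q ρ s' * ballLaw q ρ (-(c' * s' + y) / c))) :=
        Finset.sum_congr rfl fun s' _ => by rw [htilt]; ring
    -- By `ab ≤ (a² + b²) / 2`, both squares sum to the collision probability because `s' ↦ -(c' s'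
    -- + y) / c` is a bijection.
    _ ≤ ∑ s' : F, (ballLaw q ρ s' + g * ((ballLaw q ρ s' ^ 2
          + ballLaw q ρ (-(c' * s' + y) / c) ^ 2) / 2)) := by
        gcongr with s' _
        nlinarith [sq_nonneg (ballLaw q ρ s' - ballLaw q ρ (-(c' * s' + y) / c))]
    _ = _ := by
        rw [Finset.sum_add_distrib, ← Finset.mul_sum, ← Finset.sum_div, Finset.sum_add_distrib,
          hsq, sum_ballLaw_sq hq, sum_ballLaw hq]
        ring

/-- Below `1 - 1/q` a nonzero symbol costs more than a zero, so the worst case is weight exactly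
`ρ`, whose cost is the entropy. -/
theorem sum_neg_log_ballLaw_le (hq : q = Fintype.card F) (h0 : 0 < ρ) (h1 : ρ < 1 - 1 / (q : ℝ))
    {n : ℕ} (hn : 0 < n) {v : Fin n → F} (hv : wt v ≤ ρ) :
    ∑ t, -Real.log (ballLaw q ρ (v t)) ≤ n * Real.qaryEntropy q ρ := by
  have h2 := two_le_card hq
  have hρ := lt_one_of_lt h1
  have h3 : ∀ t, -Real.log (ballLaw q ρ (v t))
      = if v t = 0 then -Real.log (1 - ρ) else -Real.log (ρ / (q - 1)) := by
    intro t; unfold ballLaw; split_ifs <;> rfl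
  rw [Finset.sum_congr rfl fun t _ => h3 t, sum_comp_eq]
  have hle : Real.log (ρ / (q - 1)) ≤ Real.log (1 - ρ) := by
    refine Real.log_le_log (div_pos h0 (by linarith)) ?_
    rw [div_le_iff₀ (by linarith)]
    exact (mul_lt_of_lt h2 h1).le
  have h4 := mul_le_mul_of_nonneg_right (hammingNorm_le_of_wt_le hn hv)
    (show 0 ≤ -Real.log (ρ / (q - 1)) - -Real.log (1 - ρ) by linarith)
  have h5 : Real.qaryEntropy q ρ = -Real.log (1 - ρ)
      + ρ * (-Real.log (ρ / (q - 1)) - -Real.log (1 - ρ)) := by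
    rw [Real.qaryEntropy, Real.binEntropy, Real.log_inv, Real.log_inv,
      Real.log_div h0.ne' (by linarith)]
    push_cast
    ring
  rw [h5]
  linarith

theorem qaryEntropy_le_log (hq : (2 : ℝ) ≤ q) (h0 : 0 < ρ) (h1 : ρ < 1) :
    Real.qaryEntropy q ρ ≤ Real.log q := by
  have hq0 : (0 : ℝ) < q := by linarith
  have key : ∀ x : ℝ, 0 < x → Real.log x ≤ x / q - 1 + Real.log q := by
    intro x hx
    have := Real.log_le_sub_one_of_pos (div_pos hx hq0)
    rw [Real.log_div hx.ne' hq0.ne'] at this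
    linarith
  have a := mul_le_mul_of_nonneg_left (key ((q - 1) / ρ) (div_pos (by linarith) h0)) h0.le
  have b := mul_le_mul_of_nonneg_left (key (1 / (1 - ρ)) (by
    have : 0 < 1 - ρ := by linarith
    positivity)) (show 0 ≤ 1 - ρ by linarith)
  have h1' : 1 - ρ ≠ 0 := by linarith
  have e1 : ρ * ((q - 1) / ρ / q - 1 + Real.log q) = (q - 1) / q - ρ + ρ * Real.log q := by
    field_simp
  have e2 : (1 - ρ) * (1 / (1 - ρ) / q - 1 + Real.log q)
      = 1 / q - (1 - ρ) + (1 - ρ) * Real.log q := by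
    field_simp
  have e3 : ((q : ℝ) - 1) / q = 1 - 1 / q := by field_simp
  rw [e1, e3, Real.log_div (by linarith) h0.ne'] at a
  rw [e2, Real.log_div one_ne_zero h1', Real.log_one] at b
  rw [Real.qaryEntropy, Real.binEntropy, Real.log_inv, Real.log_inv]
  push_cast
  linarith

/-- Gibbs' inequality for vectors of small weight with several low-weight combinations. -/
theorem ent_rows_le {κ : Type*} [Fintype κ] [DecidableEq κ] (hq : q = Fintype.card F) (h0 : 0 < ρ)
    (h1 : ρ < 1 - 1 / (q : ℝ)) {n : ℕ} (hn : 0 < n) (b : κ → Fin n → F) (hb : ∀ k, wt (b k) ≤ ρ)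
    {d : ℕ} (l : Fin d → κ → F) (hl : ∀ r, wt (∑ k, l r k • b k) ≤ ρ) {g Z : ℝ} (hg : 0 ≤ g)
    (hZ0 : 0 < Z)
    (hZ : ∑ f : κ → F, (∏ k, ballLaw q ρ (f k)) * ∏ r, tilt g (∑ k, l r k * f k) ≤ Z) :
    ent (fun t k => b k t) ≤ Fintype.card κ * Real.qaryEntropy q ρ + Real.log Z
      - d * ((1 - ρ) * Real.log (1 + g)) := by
  have hρ := lt_one_of_lt h1
  have hn' : (0 : ℝ) < n := by exact_mod_cast hn
  have : Nonempty (Fin n) := ⟨⟨0, hn⟩⟩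
  have hlg : 0 ≤ Real.log (1 + g) := Real.log_nonneg (by linarith)
  have htpos : ∀ x : F, 0 < tilt g x := by
    intro x
    unfold tilt
    split_ifs <;> linarith
  -- The reference law is the product of ball laws, favouring symbols at which the combinations `l
  -- r` vanish, normalised by `Z`.
  set ν : (κ → F) → ℝ := fun f =>
    (∏ k, ballLaw q ρ (f k)) * (∏ r, tilt g (∑ k, l r k * f k)) / Z with hν
  have hp1 : ∀ f : κ → F, 0 < ∏ k, ballLaw q ρ (f k) := fun f =>
    Finset.prod_pos fun k _ => ballLaw_pos hq h0 hρ _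
  have hp2 : ∀ f : κ → F, 0 < ∏ r, tilt g (∑ k, l r k * f k) := fun f =>
    Finset.prod_pos fun r _ => htpos _
  have hgibbs := ent_le_of_sum_le_one (fun (t : Fin n) k => b k t) ν
    (fun f => div_pos (mul_pos (hp1 f) (hp2 f)) hZ0)
    (by rw [← Finset.sum_div]; exact (div_le_one hZ0).2 hZ)
  refine hgibbs.trans ?_
  rw [Fintype.card_fin, div_le_iff₀ hn']
  have hlog : ∀ t, -Real.log (ν fun k => b k t)
      = ∑ k, -Real.log (ballLaw q ρ (b k t))
        - ∑ r, Real.log (tilt g ((∑ k, l r k • b k) t)) + Real.log Z := by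
    intro t
    simp only [hν]
    rw [Real.log_div (mul_pos (hp1 _) (hp2 _)).ne' hZ0.ne', Real.log_mul (hp1 _).ne' (hp2 _).ne',
      Real.log_prod fun k _ => (ballLaw_pos hq h0 hρ _).ne',
      Real.log_prod fun r _ => (htpos _).ne', Finset.sum_neg_distrib]
    simp only [Finset.sum_apply, Pi.smul_apply, smul_eq_mul]
    ring
  rw [Finset.sum_congr rfl fun t _ => hlog t, Finset.sum_add_distrib, Finset.sum_sub_distrib,
    Finset.sum_comm, Finset.sum_comm (f := fun t r => Real.log (tilt g ((∑ k, l r k • b k) t)))]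
  have hA : ∑ k, ∑ t, -Real.log (ballLaw q ρ (b k t))
      ≤ Fintype.card κ * (n * Real.qaryEntropy q ρ) := by
    refine (Finset.sum_le_sum fun k _ => sum_neg_log_ballLaw_le hq h0 h1 hn (hb k)).trans ?_
    rw [Finset.sum_const, nsmul_eq_mul, Finset.card_univ]
  have hB : d * (n * ((1 - ρ) * Real.log (1 + g)))
      ≤ ∑ r, ∑ t, Real.log (tilt g ((∑ k, l r k • b k) t)) := by
    calc _ = ∑ _r : Fin d, n * ((1 - ρ) * Real.log (1 + g)) := by
          rw [Finset.sum_const, nsmul_eq_mul, Finset.card_univ, Fintype.card_fin]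
      _ ≤ _ := by
          refine Finset.sum_le_sum fun r _ => ?_
          have h3 : ∀ t, Real.log (tilt g ((∑ k, l r k • b k) t))
              = if (∑ k, l r k • b k) t = 0 then Real.log (1 + g) else 0 := by
            intro t; unfold tilt; split_ifs <;> simp
          rw [Finset.sum_congr rfl fun t _ => h3 t, sum_comp_eq]
          have := mul_le_mul_of_nonneg_right (hammingNorm_le_of_wt_le hn (hl r)) hlg
          linarith
  rw [Finset.sum_const, nsmul_eq_mul, Finset.card_univ, Fintype.card_fin]
  linarith

theorem ent_rows_le_card_mul {κ : Type*} [Fintype κ] [DecidableEq κ] (hq : q = Fintype.card F)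
    (h0 : 0 < ρ) (h1 : ρ < 1 - 1 / (q : ℝ)) {n : ℕ} (hn : 0 < n) (b : κ → Fin n → F)
    (hb : ∀ k, wt (b k) ≤ ρ) :
    ent (fun t k => b k t) ≤ Fintype.card κ * Real.qaryEntropy q ρ := by
  have h := ent_rows_le hq h0 h1 hn b hb (d := 0) (fun r => r.elim0) (fun r => r.elim0)
    (g := 0) (Z := 1) le_rfl one_pos (by
      have := Fintype.prod_sum fun (_ : κ) (x : F) => ballLaw q ρ x
      simp [← this, sum_ballLaw hq])
  simpa using h

theorem setEnt_singleton_le (hq : q = Fintype.card F) (h0 : 0 < ρ) (h1 : ρ < 1 - 1 / (q : ℝ))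
    {n : ℕ} (hn : 0 < n) {v : Fin n → F} (hv : wt v ≤ ρ) :
    setEnt {v} ≤ Real.qaryEntropy q ρ := by
  have h := ent_rows_le_card_mul (κ := Unit) hq h0 h1 hn (fun _ => v) fun _ => hv
  rw [← setEnt_range] at h
  simpa using h

/-- The tilting parameter. -/
noncomputable def tiltParam (q : ℕ) (ρ : ℝ) : ℝ := (1 - ρ - collision q ρ) / (2 * collision q ρ)

/-- The gain in entropy from each link of a chain. -/
noncomputable def chainGain (q : ℕ) (ρ : ℝ) : ℝ :=
  (1 - ρ) * Real.log (1 + tiltParam q ρ) - Real.log (1 + tiltParam q ρ * collision q ρ)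

/-- The length of a chain whose total gain exceeds `2 log q`. -/
noncomputable def chainLength (q : ℕ) (ρ : ℝ) : ℕ := ⌈2 * Real.log q / chainGain q ρ⌉₊

theorem tiltParam_pos (hq : (2 : ℝ) ≤ q) (h0 : 0 < ρ) (h1 : ρ < 1 - 1 / (q : ℝ)) :
    0 < tiltParam q ρ := by
  have a := collision_pos hq (lt_one_of_lt h1)
  have b := collision_lt hq h0 h1
  exact div_pos (by linarith) (by linarith)

/-- With `c` the collision probability, `tiltParam` makes `c (1 + g)` the midpoint of `c` and `1 -
ρ`. Then `log (1 + g c) ≤ g c < (1 - ρ) g / (1 + g) ≤ (1 - ρ) log (1 + g)`. -/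
theorem chainGain_pos (hq : (2 : ℝ) ≤ q) (h0 : 0 < ρ) (h1 : ρ < 1 - 1 / (q : ℝ)) :
    0 < chainGain q ρ := by
  have a := collision_pos hq (lt_one_of_lt h1)
  have b := collision_lt hq h0 h1
  have hg := tiltParam_pos hq h0 h1
  have hρ := lt_one_of_lt h1
  set g := tiltParam q ρ with hgdef
  have e : 2 * (g * collision q ρ) = 1 - ρ - collision q ρ := by
    rw [hgdef, tiltParam]
    field_simp
  have l1 : Real.log (1 + g * collision q ρ) ≤ g * collision q ρ := by
    have := Real.log_le_sub_one_of_pos (show 0 < 1 + g * collision q ρ by positivity)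
    linarith
  have l2 : g / (1 + g) ≤ Real.log (1 + g) := by
    have := Real.one_sub_inv_le_log_of_pos (show 0 < 1 + g by linarith)
    have e2 : 1 - (1 + g)⁻¹ = g / (1 + g) := by field_simp; ring
    rwa [e2] at this
  have l3 : g * collision q ρ < (1 - ρ) * (g / (1 + g)) := by
    rw [← mul_div_assoc, lt_div_iff₀ (by linarith)]
    nlinarith [mul_pos hg a, mul_pos (mul_pos hg a) hg]
  have l4 := mul_le_mul_of_nonneg_left l2 (show 0 ≤ 1 - ρ by linarith)
  unfold chainGain
  rw [← hgdef]
  linarith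

theorem two_log_le_chainLength_mul (hq : (2 : ℝ) ≤ q) (h0 : 0 < ρ) (h1 : ρ < 1 - 1 / (q : ℝ)) :
    2 * Real.log q ≤ chainLength q ρ * chainGain q ρ := by
  rw [← div_le_iff₀ (chainGain_pos hq h0 h1)]
  exact Nat.le_ceil _

/-- If many combinations of low-weight vectors have low weight, the joint entropy drops. -/
theorem ent_rows_le_of_card_lt {κ : Type*} [Fintype κ] [DecidableEq κ] (hq : q = Fintype.card F)
    (h0 : 0 < ρ) (h1 : ρ < 1 - 1 / (q : ℝ)) {n : ℕ} (hn : 0 < n) (b : κ → Fin n → F)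
    (hb : ∀ k, wt (b k) ≤ ρ) (A : Finset (κ → F)) (hA : ∀ a ∈ A, wt (∑ k, a k • b k) ≤ ρ)
    (hcard : (4 * q ^ 2) ^ chainLength q ρ * (1 + q * Fintype.card κ) < A.card) :
    ent (fun t k => b k t) ≤ Fintype.card κ * Real.qaryEntropy q ρ - Real.log q := by
  have hq2 := two_le_card hq
  have hρ := lt_one_of_lt h1
  have hg := tiltParam_pos hq2 h0 h1
  have hc := collision_pos hq2 hρ
  set g := tiltParam q ρ with hgdef
  set d := chainLength q ρ with hd
  have hμ : 0 < 1 + g * collision q ρ := by positivity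
  have htpos : ∀ x : F, 0 ≤ tilt g x := by
    intro x; unfold tilt; split_ifs <;> linarith
  have hb0 : ∀ x : F, 0 ≤ ballLaw q ρ x := fun x => (ballLaw_pos hq h0 hρ x).le
  rw [hq] at hcard
  obtain ⟨w, -, l, hl, hchain⟩ := exists_chain hb0 (sum_ballLaw hq)
    htpos hμ.le (sum_sum_tilt_le hq hg.le) d A hcard
  -- The common shift `∑ w k * f k` depends on `f`; summing over all its possible values `y` costs a
  -- factor `q`. This uses one of the two `log q` gained by the chain.
  have hZ : ∑ f : κ → F, (∏ k, ballLaw q ρ (f k)) * ∏ r, tilt g (∑ k, l r k * f k)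
      ≤ q * (1 + g * collision q ρ) ^ d := by
    calc _ ≤ ∑ f : κ → F, ∑ y : F, (∏ k, ballLaw q ρ (f k)) *
          ∏ r, tilt g (∑ k, (l r k - w k) * f k + y) := by
          refine Finset.sum_le_sum fun f _ => ?_
          have h2 : ∀ r, ∑ k, l r k * f k = ∑ k, (l r k - w k) * f k + ∑ k, w k * f k := by
            intro r
            rw [← Finset.sum_add_distrib]
            exact Finset.sum_congr rfl fun k _ => by ring
          simp only [h2]
          exact Finset.single_le_sum (f := fun y => (∏ k, ballLaw q ρ (f k)) *
            ∏ r, tilt g (∑ k, (l r k - w k) * f k + y))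
            (fun y _ => mul_nonneg (Finset.prod_nonneg fun k _ => hb0 _)
              (Finset.prod_nonneg fun r _ => htpos _)) (Finset.mem_univ _)
      _ ≤ ∑ _y : F, (1 + g * collision q ρ) ^ d := by
          rw [Finset.sum_comm]
          exact Finset.sum_le_sum fun y _ => hchain y
      _ = _ := by rw [Finset.sum_const, nsmul_eq_mul, Finset.card_univ, ← hq]
  have key := ent_rows_le hq h0 h1 hn b hb l (fun r => hA _ (hl r)) hg.le
    (mul_pos (by linarith) (pow_pos hμ d)) hZ
  rw [Real.log_mul (by linarith) (pow_pos hμ d).ne', Real.log_pow] at key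
  have hgain := two_log_le_chainLength_mul hq2 h0 h1
  rw [chainGain, ← hgdef, ← hd] at hgain
  linarith

end Weights

/-! ### From a failure of list decoding to a subspace of small entropy. -/

section Structure

variable {F : Type*} [Field F] {n : ℕ} {ρ : ℝ}

theorem card_le_pow_finrank_vectorSpan [Fintype F] (S : Finset (Fin n → F)) :
    S.card ≤ Fintype.card F ^ Module.finrank F (vectorSpan F (S : Set (Fin n → F))) := by
  classical
  rcases S.eq_empty_or_nonempty with rfl | ⟨s, hs⟩
  · simp
  have hfin : Fintype (vectorSpan F (S : Set (Fin n → F))) := Fintype.ofFinite _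
  rw [← Module.card_eq_pow_finrank (K := F), ← Fintype.card_coe S]
  refine Fintype.card_le_of_injective
    (fun v : S => (⟨v.1 - s, vsub_mem_vectorSpan F v.2 hs⟩ : vectorSpan F (S : Set (Fin n → F))))
    fun v w h => Subtype.ext (sub_left_injective (Subtype.ext_iff.mp h))

theorem finrank_span_le_finrank_vectorSpan_add_one (S : Set (Fin n → F)) :
    Module.finrank F (Submodule.span F S) ≤ Module.finrank F (vectorSpan F S) + 1 := by
  rcases S.eq_empty_or_nonempty with rfl | ⟨s, hs⟩
  · rw [Submodule.span_empty, finrank_bot]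
    exact Nat.zero_le _
  have hle : Submodule.span F S ≤ vectorSpan F S ⊔ Submodule.span F {s} := by
    rw [Submodule.span_le]
    intro v hv
    have h1 : v - s ∈ vectorSpan F S := vsub_mem_vectorSpan F hv hs
    have h2 := Submodule.add_mem_sup h1 (Submodule.mem_span_singleton_self (R := F) s)
    rwa [sub_add_cancel] at h2
  refine (Submodule.finrank_mono hle).trans ((Submodule.finrank_add_le_finrank_add_finrank _ _).trans
    (Nat.add_le_add_left ?_ _))
  exact (finrank_span_le_card ({s} : Set (Fin n → F))).trans (by simp)

/-- Lifting a basis of `V` to `D` gives the tuple counted by the union bound; the lifts are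
independent because their images are. -/
theorem exists_codewords_of_le_puncture {m : ℕ} {i : Fin n → Fin m}
    {D : Submodule F (Fin m → F)} {V : Submodule F (Fin n → F)} (hV : V ≤ puncture i D) :
    ∃ u : Fin (Module.finrank F V) → D, LinearIndependent F u ∧
      ent (fun (t : Fin n) (j : Fin (Module.finrank F V)) => (u j : Fin m → F) (i t))
        ≤ setEnt (V : Set (Fin n → F)) := by
  let b := Module.finBasis F V
  have hpre : ∀ j, ∃ x : D, LinearMap.funLeft F F i (x : Fin m → F) = (b j : Fin n → F) := by
    intro j
    obtain ⟨x, hx, hxb⟩ := Submodule.mem_map.mp (hV (b j).2)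
    exact ⟨⟨x, hx⟩, hxb⟩
  choose u hu using hpre
  refine ⟨u, ?_, ?_⟩
  · refine LinearIndependent.of_comp ((LinearMap.funLeft F F i).comp D.subtype) ?_
    have : ⇑((LinearMap.funLeft F F i).comp D.subtype) ∘ u = V.subtype ∘ b :=
      funext fun j => hu j
    rw [this]
    exact b.linearIndependent.map' V.subtype (Submodule.ker_subtype V)
  · have h1 : (fun (t : Fin n) (j : Fin (Module.finrank F V)) => (u j : Fin m → F) (i t))
        = fun t j => (b j : Fin n → F) t :=
      funext fun t => funext fun j => congrFun (hu j) t
    rw [h1, ← setEnt_range]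
    refine setEnt_mono ?_
    rintro _ ⟨j, rfl⟩
    exact Submodule.subset_span (b j).2

variable [DecidableEq F]

/-- Translate the centre to the origin. The vectors may leave `C`, but their differences do not,
hence the role of `vectorSpan`. -/
theorem exists_clustered_of_not_isListDecodable {L : ℕ} {C : Submodule F (Fin n → F)}
    (h : ¬ IsListDecodable ρ L (C : Set (Fin n → F))) :
    ∃ S : Finset (Fin n → F), S.card = L + 1 ∧ vectorSpan F (S : Set (Fin n → F)) ≤ C ∧
      ∀ v ∈ S, wt v ≤ ρ := by
  rw [IsListDecodable, not_not] at h
  obtain ⟨W, hWC, hcard, z, hz⟩ := h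
  refine ⟨W.image fun u => u - z, ?_, ?_, ?_⟩
  · rw [Finset.card_image_of_injective _ sub_left_injective, hcard]
  · rw [vectorSpan_def, Submodule.span_le]
    rintro _ ⟨x, hx, y, hy, rfl⟩
    simp only [Finset.coe_image, Set.mem_image] at hx hy
    obtain ⟨u, hu, rfl⟩ := hx
    obtain ⟨v, hv, rfl⟩ := hy
    have := C.sub_mem (hWC hu) (hWC hv)
    simpa using this
  · intro v hv
    obtain ⟨u, hu, rfl⟩ := Finset.mem_image.mp hv
    exact hz u hu

theorem finrank_vectorSpan_le_of_card {S : Finset (Fin n → F)} {L : ℕ} (h : S.card = L + 1) :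
    Module.finrank F (vectorSpan F (S : Set (Fin n → F))) ≤ L := by
  have h2 := finrank_vectorSpan_image_finset_le F (id : (Fin n → F) → Fin n → F) S h
  rwa [Finset.image_id] at h2

/-- A clustered set over the two-element field has a subspace of differences, of dimension at
least two, with small entropy. -/
theorem exists_submodule_of_not_isListDecodable_binary [Fintype F] (hF : Fintype.card F = 2)
    (h0 : 0 < ρ) (h1 : ρ < 1 - 1 / ((2 : ℕ) : ℝ)) (hn : 0 < n) {L : ℕ} (hL : 3 ≤ L)
    {C : Submodule F (Fin n → F)} (h : ¬ IsListDecodable ρ L (C : Set (Fin n → F))) {θ : ℝ}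
    (hθ : Real.qaryEntropy 2 ρ * (((L : ℝ) - 1) / ((L : ℝ) - 2)) ≤ θ) :
    ∃ V ≤ C, 2 ≤ Module.finrank F V ∧ Module.finrank F V ≤ L ∧
      setEnt (V : Set (Fin n → F)) ≤ Module.finrank F V * θ := by
  obtain ⟨S, hcard, hSC, hS⟩ := exists_clustered_of_not_isListDecodable h
  by_contra hcon
  push Not at hcon
  have hL' : (3 : ℝ) ≤ L := by exact_mod_cast hL
  set H := Real.qaryEntropy 2 ρ with hH
  have hHpos : 0 < H := Real.qaryEntropy_pos h0 (lt_one_of_lt h1)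
  -- The ratio `(L + 1) / L`, at most `(L - 1) / (L - 2)`, is all that the contradiction needs:
  -- entropy above `k θ` and at most `(k + 1) θ - (θ - H)(L + 1)` would force `L θ < H (L + 1)`.
  have hHθ : H * (L + 1) ≤ L * θ := by
    have h2 : H * (((L : ℝ) - 1) / ((L : ℝ) - 2)) * L ≤ θ * L := by gcongr
    have h3 : H * (L + 1) ≤ H * (((L : ℝ) - 1) / ((L : ℝ) - 2)) * L := by
      rw [mul_assoc]
      gcongr
      rw [div_mul_eq_mul_div, le_div_iff₀ (by linarith)]
      nlinarith
    linarith
  have hθ0 : 0 ≤ θ := by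
    by_contra hneg
    have : (L : ℝ) * θ < 0 := mul_neg_of_pos_of_neg (by linarith) (not_le.1 hneg)
    nlinarith
  have hdimL : ∀ I ≤ vectorSpan F (S : Set (Fin n → F)), Module.finrank F I ≤ L := fun I hI =>
    (Submodule.finrank_mono hI).trans (finrank_vectorSpan_le_of_card hcard)
  have hbound := setEnt_le_of_forall_two_le_finrank hF hθ0 S
    (Finset.card_pos.1 (by omega)) (fun v hv => setEnt_singleton_le hF.symm h0 h1 hn (hS v hv))
    fun I hI h2 => by
      rw [mul_comm]
      exact (hcon I (hI.trans hSC) h2 (hdimL I hI)).le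
  have hk2 : 2 ≤ Module.finrank F (vectorSpan F (S : Set (Fin n → F))) := by
    by_contra hlt
    have h3 := card_le_pow_finrank_vectorSpan S
    have h4 : Fintype.card F ^ Module.finrank F (vectorSpan F (S : Set (Fin n → F))) ≤ 2 ^ 1 := by
      rw [hF]
      exact Nat.pow_le_pow_right (by norm_num) (by omega)
    omega
  have h5 := hcon _ hSC hk2 (hdimL _ le_rfl)
  have h6 : setEnt ((vectorSpan F (S : Set (Fin n → F)) : Submodule F (Fin n → F)) :
      Set (Fin n → F)) ≤ setEnt (S : Set (Fin n → F)) := setEnt_mono (vectorSpan_le_span _)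
  rw [hcard, ← hH] at hbound
  push_cast at hbound
  nlinarith

/-- The constant in the list size for general `q`. -/
noncomputable def listConst (q : ℕ) (ρ : ℝ) : ℝ := 4 * q * (4 * (q : ℝ) ^ 2) ^ chainLength q ρ

theorem setEnt_vectorSpan_le [Fintype F] {q : ℕ} (hq : q = Fintype.card F) (h0 : 0 < ρ)
    (h1 : ρ < 1 - 1 / (q : ℝ)) (hn : 0 < n) {L : ℕ} (hL : 1 ≤ L) {S : Finset (Fin n → F)}
    (hcard : S.card = L + 1) (hS : ∀ v ∈ S, wt v ≤ ρ)
    (hk : 1 ≤ Module.finrank F (vectorSpan F (S : Set (Fin n → F)))) :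
    setEnt ((vectorSpan F (S : Set (Fin n → F)) : Submodule F (Fin n → F)) : Set (Fin n → F))
      ≤ Module.finrank F (vectorSpan F (S : Set (Fin n → F))) *
        (Real.qaryEntropy q ρ + listConst q ρ / L * Real.log q) := by
  classical
  have hq2 := two_le_card hq
  have hρ := lt_one_of_lt h1
  have hL' : (1 : ℝ) ≤ L := by exact_mod_cast hL
  have hlq : 0 < Real.log q := Real.log_pos (by linarith)
  set H := Real.qaryEntropy q ρ with hH
  have hHpos : 0 < H := Real.qaryEntropy_pos h0 hρ
  have hHle : H ≤ Real.log q := qaryEntropy_le_log hq2 h0 hρ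
  set k := Module.finrank F (vectorSpan F (S : Set (Fin n → F))) with hkdef
  have hk' : (1 : ℝ) ≤ k := by exact_mod_cast hk
  obtain ⟨B, hBS, hspan, hli⟩ := exists_linearIndependent F (S : Set (Fin n → F))
  have hfin : Fintype B := (S.finite_toSet.subset hBS).fintype
  set r := Fintype.card B with hr
  have hrk : r ≤ k + 1 := by
    have h2 := finrank_span_eq_card hli
    rw [Subtype.range_coe] at h2
    rw [hr, ← h2, hspan]
    exact finrank_span_le_finrank_vectorSpan_add_one _
  have hr' : (r : ℝ) ≤ k + 1 := by exact_mod_cast hrk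
  have hBwt : ∀ b : B, wt (b : Fin n → F) ≤ ρ := fun b => hS b (hBS b.2)
  have hle : setEnt ((vectorSpan F (S : Set (Fin n → F)) : Submodule F (Fin n → F)) :
      Set (Fin n → F)) ≤ ent fun (t : Fin n) (b : B) => (b : Fin n → F) t := by
    refine setEnt_mono fun v hv => ?_
    rw [hspan]
    exact vectorSpan_le_span _ hv
  refine hle.trans ?_
  have hc0 : 0 ≤ listConst q ρ / L * Real.log q := by
    unfold listConst
    positivity
  -- The basis may have `k + 1` elements, one more than is allowed for. In the first case `L ≤ k ·
  -- listConst`, so the error term covers the extra `H ≤ log q`; in the second the chain saves `log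
  -- q`.
  by_cases hsmall : S.card ≤ (4 * q ^ 2) ^ chainLength q ρ * (1 + q * r)
  · have h2 := ent_rows_le_card_mul hq h0 h1 hn (fun b : B => (b : Fin n → F)) hBwt
    refine h2.trans ?_
    have h3 : ((L : ℝ) + 1) ≤ (4 * (q : ℝ) ^ 2) ^ chainLength q ρ * (1 + q * r) := by
      rw [hcard] at hsmall
      exact_mod_cast hsmall
    have h4 : (L : ℝ) ≤ k * listConst q ρ := by
      have h5 : (1 : ℝ) + q * r ≤ 4 * q * k := by nlinarith
      have h6 := mul_le_mul_of_nonneg_left h5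
        (show 0 ≤ (4 * (q : ℝ) ^ 2) ^ chainLength q ρ by positivity)
      unfold listConst
      linarith
    have h7 : 1 ≤ k * (listConst q ρ / L) := by
      rw [← mul_div_assoc, le_div_iff₀ (by linarith), one_mul]
      exact h4
    have h8 := mul_le_mul_of_nonneg_right h7 hlq.le
    have h9 := mul_le_mul_of_nonneg_right hr' hHpos.le
    rw [← hr]
    linarith
  · have hcoef : ∀ v : S, ∃ a : B → F, ∑ b, a b • (b : Fin n → F) = v := by
      intro v
      have hv : (v : Fin n → F) ∈ Submodule.span F (Set.range ((↑) : B → Fin n → F)) := by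
        rw [Subtype.range_coe, hspan]
        exact Submodule.subset_span v.2
      exact (Submodule.mem_span_range_iff_exists_fun F).mp hv
    choose a ha using hcoef
    have hinj : Function.Injective a := fun v w h => Subtype.ext (by rw [← ha v, ← ha w, h])
    have h2 := ent_rows_le_of_card_lt hq h0 h1 hn (fun b : B => (b : Fin n → F)) hBwt
      (Finset.univ.image a) (fun x hx => by
        obtain ⟨v, -, rfl⟩ := Finset.mem_image.mp hx
        rw [ha v]
        exact hS v v.2)
      (by
        rw [Finset.card_image_of_injective _ hinj, Finset.card_univ, Fintype.card_coe]
        exact not_le.1 hsmall)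
    refine h2.trans ?_
    have h9 := mul_le_mul_of_nonneg_right hr' hHpos.le
    have h10 : 0 ≤ k * (listConst q ρ / L * Real.log q) := by positivity
    rw [← hr]
    linarith

theorem exists_submodule_of_not_isListDecodable [Fintype F] {q : ℕ} (hq : q = Fintype.card F)
    (h0 : 0 < ρ) (h1 : ρ < 1 - 1 / (q : ℝ)) (hn : 0 < n) {L : ℕ} (hL : 1 ≤ L)
    {C : Submodule F (Fin n → F)} (h : ¬ IsListDecodable ρ L (C : Set (Fin n → F))) :
    ∃ V ≤ C, 1 ≤ Module.finrank F V ∧ Module.finrank F V ≤ L ∧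
      setEnt (V : Set (Fin n → F)) ≤ Module.finrank F V *
        (Real.qaryEntropy q ρ + listConst q ρ / L * Real.log q) := by
  obtain ⟨S, hcard, hSC, hS⟩ := exists_clustered_of_not_isListDecodable h
  have hk : 1 ≤ Module.finrank F (vectorSpan F (S : Set (Fin n → F))) := by
    by_contra hlt
    have h3 := card_le_pow_finrank_vectorSpan S
    have h4 : Module.finrank F (vectorSpan F (S : Set (Fin n → F))) = 0 := by omega
    rw [h4, pow_zero] at h3
    omega
  exact ⟨_, hSC, hk, finrank_vectorSpan_le_of_card hcard,
    setEnt_vectorSpan_le hq h0 h1 hn hL hcard hS hk⟩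

end Structure

/-! ### Absorbing the loss from the bias. -/

section Numerics

theorem add_three_le_two_pow {j : ℕ} (hj : 1 ≤ j) : j + 3 ≤ 2 ^ (j + 1) := by
  induction j, hj using Nat.le_induction with
  | base => norm_num
  | succ j hj ih => rw [pow_succ]; omega

/-- In dimension `k` the rate gap supplies `k ε`, of which `ε` is kept; the other `(k - 1) ε` must
cover the bias. Nothing is left when `k = 1`, and equality holds at `q = 2`, `k = L = 3`. -/
theorem succ_mul_pow_div_le {q : ℝ} (hq : 2 ≤ q) {k L : ℕ} (hL : 3 ≤ L) (hk : 2 ≤ k)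
    (hkL : k ≤ L) : ((L : ℝ) + 1) * (q ^ k / q ^ (L + 1)) ≤ k - 1 := by
  obtain ⟨j, rfl⟩ := Nat.exists_eq_add_of_le hkL
  have hq0 : 0 < q := by linarith
  have e : q ^ k / q ^ (k + j + 1) = 1 / q ^ (j + 1) := by
    rw [show k + j + 1 = k + (j + 1) by ring, pow_add]
    field_simp
  have hnat : k + j + 1 ≤ (k - 1) * 2 ^ (j + 1) := by
    obtain ⟨i, rfl⟩ := Nat.exists_eq_add_of_le hk
    rcases Nat.eq_zero_or_pos j with rfl | hj
    · norm_num
      omega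
    · have h1 := Nat.mul_le_mul_left (2 + i - 1) (add_three_le_two_pow hj)
      have h2 : 2 + i - 1 = i + 1 := by omega
      rw [h2] at h1 ⊢
      nlinarith
  have hreal : ((k + j : ℕ) : ℝ) + 1 ≤ (k - 1) * q ^ (j + 1) := by
    have h1 : ((k + j + 1 : ℕ) : ℝ) ≤ (((k - 1) * 2 ^ (j + 1) : ℕ) : ℝ) := by exact_mod_cast hnat
    have h2 : (2 : ℝ) ^ (j + 1) ≤ q ^ (j + 1) := pow_le_pow_left₀ (by norm_num) hq _
    have h3 : (0 : ℝ) ≤ k - 1 := by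
      have : (2 : ℝ) ≤ k := by exact_mod_cast hk
      linarith
    rw [Nat.cast_mul, Nat.cast_sub (by omega)] at h1
    push_cast at h1 ⊢
    exact h1.trans (mul_le_mul_of_nonneg_left h2 h3)
  rw [e, mul_one_div, div_le_iff₀ (by positivity)]
  exact hreal

theorem mul_succ_le_two_pow {L : ℕ} (hL : 2 ≤ L) : L * (L + 1) ≤ 8 * 2 ^ L := by
  induction L, hL using Nat.le_induction with
  | base => norm_num
  | succ L hL ih => rw [pow_succ]; nlinarith

/-- The case `k = 1`, paid for by the summand 8 in the constant of the first claim. -/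
theorem succ_mul_div_pow_le {q : ℝ} (hq : 2 ≤ q) {L : ℕ} (hL : 2 ≤ L) :
    ((L : ℝ) + 1) * (q ^ 1 / q ^ (L + 1)) ≤ 8 / L := by
  have hq0 : 0 < q := by linarith
  have hL0 : (0 : ℝ) < L := by exact_mod_cast (show 0 < L by omega)
  have e : q ^ 1 / q ^ (L + 1) = 1 / q ^ L := by
    rw [pow_one, pow_succ']
    field_simp
  have h1 : (L : ℝ) * (L + 1) ≤ 8 * 2 ^ L := by exact_mod_cast mul_succ_le_two_pow hL
  have h2 : (2 : ℝ) ^ L ≤ q ^ L := pow_le_pow_left₀ (by norm_num) hq _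
  rw [e, mul_one_div, div_le_div_iff₀ (by positivity) hL0]
  linarith

end Numerics

end PuncturedCode

/-! ### Assembly of the two claims. -/

theorem mainTheorem6 :
    ∃ C : ℕ → ℝ → ℝ, ∀ δ : ℝ, 0 < δ → ∃ K : ℝ,
      ∀ (p : ℕ) [Fact p.Prime] (F : Type*) [Field F] [Fintype F] [DecidableEq F]
        [Algebra (ZMod p) F] (q : ℕ), q = Fintype.card F →
      ∀ (ρ : ℝ), 0 < ρ → ρ < 1 - 1 / (q : ℝ) →
      ∀ (L : ℕ), 1 ≤ L →
      ∀ (ε : ℝ), 0 < ε →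
      ∀ (m n : ℕ) [NeZero m], 2 ≤ n →
        K * (q : ℝ) ^ (2 * (L + 1)) ≤ (n : ℝ) / Real.log n →
      ∀ D : Submodule F (Fin m → F),
        PuncturedCode.IsBiased p (ε * ((L : ℝ) + 1) * Real.log q / (q : ℝ) ^ (L + 1)) D →
        (PuncturedCode.designRate n D < 1 - PuncturedCode.entropy q ρ - C q ρ / L - ε →
          1 - (q : ℝ) ^ (-(ε - δ) * (n : ℝ)) ≤ PuncturedCode.probListDecodable n ρ L D) ∧
        (q = 2 → 3 ≤ L →
          PuncturedCode.designRate n D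
            < 1 - PuncturedCode.entropy 2 ρ * (((L : ℝ) - 1) / ((L : ℝ) - 2)) - ε →
          1 - (2 : ℝ) ^ (-(ε - δ) * (n : ℝ)) ≤ PuncturedCode.probListDecodable n ρ L D) := by
  refine ⟨fun q ρ => PuncturedCode.listConst q ρ + 8, fun δ hδ => ⟨3 / (δ * Real.log 2), ?_⟩⟩
  intro p _ F _ _ _ _ q hq ρ h0 h1 L hL ε hε m n _ hn hK D hD
  have hq2 := PuncturedCode.two_le_card hq
  have hL' : (1 : ℝ) ≤ L := by exact_mod_cast hL
  have hlq : 0 < Real.log q := Real.log_pos (by linarith)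
  have hR := PuncturedCode.designRate_nonneg (n := n) D
  have hρ := PuncturedCode.lt_one_of_lt h1
  constructor
  · intro hrate
    have hent : 0 ≤ PuncturedCode.entropy q ρ :=
      div_nonneg (Real.qaryEntropy_nonneg h0.le hρ.le) hlq.le
    have hc : 0 ≤ PuncturedCode.listConst q ρ / L := by
      unfold PuncturedCode.listConst
      positivity
    rw [add_div] at hrate
    have h8 : 8 / (L : ℝ) < 1 := by linarith
    -- Nonnegativity of the rate and the entropy forces `ε < 1` and `L > 8`; the former lets `8 / L`
    -- dominate the bias loss for `k = 1`.
    have hε1 : ε < 1 := by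
      have : 0 ≤ 8 / (L : ℝ) := by positivity
      linarith
    have hL8 : 8 < L := by
      rw [div_lt_one (by linarith)] at h8
      exact_mod_cast h8
    subst hq
    refine PuncturedCode.le_probListDecodable p (k₀ := 1)
      (θ := PuncturedCode.entropy (Fintype.card F) ρ
        + PuncturedCode.listConst (Fintype.card F) ρ / L)
      hδ hε hn le_rfl hK hD (fun k hk => ?_) fun i hi => ?_
    · obtain ⟨hk1, hkL⟩ := Finset.mem_Icc.mp hk
      have hk1' : (1 : ℝ) ≤ k := by exact_mod_cast hk1
      have h2 : (k : ℝ) * (PuncturedCode.designRate n D + (PuncturedCode.entropy (Fintype.card F) ρ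
          + PuncturedCode.listConst (Fintype.card F) ρ / L) - 1) ≤ k * (-(8 / (L : ℝ)) - ε) :=
        mul_le_mul_of_nonneg_left (by linarith) (by linarith)
      have hx : (0 : ℝ) ≤ 8 / L := by positivity
      rw [mul_assoc ε]
      rcases hk1.eq_or_lt with rfl | hk2
      · have h3 := PuncturedCode.succ_mul_div_pow_le hq2 (L := L) (by omega)
        have h4 : ε * (((L : ℝ) + 1) * ((Fintype.card F : ℝ) ^ 1
            / (Fintype.card F : ℝ) ^ (L + 1))) ≤ 1 * (8 / L) := by gcongr
        push_cast at h2 ⊢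
        linarith
      · have h3 := PuncturedCode.succ_mul_pow_div_le hq2 (L := L) (by omega) hk2 hkL
        have h4 := mul_le_mul_of_nonneg_left h3 hε.le
        have h5 : 0 ≤ (k : ℝ) * (8 / L) := by positivity
        linarith
    · obtain ⟨V, hV, hV1, hVL, hent⟩ :=
        PuncturedCode.exists_submodule_of_not_isListDecodable rfl h0 h1 (by omega) hL hi
      obtain ⟨u, hu, hu'⟩ := PuncturedCode.exists_codewords_of_le_puncture hV
      refine ⟨_, Finset.mem_Icc.2 ⟨hV1, hVL⟩, u, hu, (hu'.trans hent).trans (le_of_eq ?_)⟩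
      rw [PuncturedCode.entropy, add_mul, div_mul_cancel₀ _ hlq.ne']
  · intro hq' hL3 hrate
    subst hq'
    have hL3' : (3 : ℝ) ≤ L := by exact_mod_cast hL3
    set θ := PuncturedCode.entropy 2 ρ * (((L : ℝ) - 1) / ((L : ℝ) - 2)) with hθ
    have hcast : (Fintype.card F : ℝ) = 2 := by rw [← hq]; norm_num
    -- There is no `C / L` slack here, so dimension one must be excluded; this is why the binary
    -- extraction yields dimension at least two.
    have key := PuncturedCode.le_probListDecodable p (k₀ := 2) (ρ := ρ) (L := L) (D := D)
      (θ := θ) hδ hε hn one_le_two (by rw [← hq]; exact hK) (by rw [← hq]; exact hD)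
      (fun k hk => ?_) fun i hi => ?_
    · rwa [hcast] at key
    · obtain ⟨hk2, hkL⟩ := Finset.mem_Icc.mp hk
      have h3 := PuncturedCode.succ_mul_pow_div_le (le_refl (2 : ℝ)) hL3 hk2 hkL
      have h4 := mul_le_mul_of_nonneg_left h3 hε.le
      have h5 : (k : ℝ) * (PuncturedCode.designRate n D + θ - 1) ≤ k * (-ε) :=
        mul_le_mul_of_nonneg_left (by linarith) (Nat.cast_nonneg k)
      rw [mul_assoc ε, hcast]
      linarith
    · obtain ⟨V, hV, hV2, hVL, hent⟩ :=
        PuncturedCode.exists_submodule_of_not_isListDecodable_binary hq.symm h0 h1 (by omega) hL3 hi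
          le_rfl
      obtain ⟨u, hu, hu'⟩ := PuncturedCode.exists_codewords_of_le_puncture hV
      refine ⟨_, Finset.mem_Icc.2 ⟨hV2, hVL⟩, u, hu, (hu'.trans hent).trans (le_of_eq ?_)⟩
      rw [← hq, hθ, PuncturedCode.entropy, mul_right_comm (_ / _), div_mul_cancel₀ _ hlq.ne']
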